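/- **Setting and definitions.** Let $(X,d)$ be a geodesic metric space. A *geodesic* is an isometric embedding $\gamma: I\to X$ of a closed interval $I\subseteq\mathbb R$ (bounded or not). *Contraction.* For $Y\subseteq X$ let $\pi_Y(x)$ be the set of points of $Y$ closest to $x$. For $D\ge 0$, $Y$ is *$D$-contracting* if $\operatorname{diam}\pi_Y(B_{d(x,Y)}(x))\le D$ for every $x\in X$, where $B_r(x)$ is the open ball and $\pi_Y(A)=\bigcup_{a\in A}\pi_Y(a)$; it is *strongly contracting* if it is $D$-contracting for some $D$. A (quasi-)geodesic is called so if its image is. *Quasi-geodesics.* For $C\ge1$, a continuous map $c:I\to Z$ to a metric space is a *$C$-quasi-geodesic* if $\frac{|t-s|}{C}-C\le d_Z(c(s),c(t))\le C|t-s|+C$ for all $s,t\in I$; it is a *quasi-geodesic* if this holds for some $C\ge 1$. *The contraction space.* A geodesic segment $\sigma$ with midpoint $m$ is *$r$-thin* if for every (possibly degenerate) geodesic quadrangle $(\gamma_1,\gamma_2,\gamma_3,\gamma_4)$ such that $\sigma$ is a subsegment of $\gamma_1$, the set $\gamma_2\cup\gamma_3\cup\gamma_4$ meets the closed $r$-ball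 around $m$. A pair $(x,y)\in X\times X$ is *anti-contracting* if $d(x,y)\ge1$ and, for all $r\ge0$, no geodesic from $x$ to $y$ has an $r$-thin subsegment of length at least $10r+1$. The *contraction space* $\hat X$ is obtained from $X$ by adding, for every anti-contracting pair $(x,y)$, an interval of length one whose endpoints are glued to $x$ and $y$; $\hat d$ is the induced path metric. We regard $X$ as a subset of $\hat X$. For a geodesic $\gamma:I\to X$, $\hat\gamma:I\to\hat X$ denotes its composition with the inclusion $X\hookrightarrow\hat X$. *Group elements.* Let $G$ be a group acting by isometries on a metric space $Z$. An element $g\in G$ *acts loxodromically* on $Z$ if for some $z\in Z$ the map $\mathbb Z\to Z$, $n\mapsto g^nz$, is a quasi-isometric embedding. It *acts strongly-contracting* on $Z$ if it acts loxodromically on $Z$ and for some $C$ there is a $C$-contracting $C$-quasi-geodesic $c:\mathbb R\to Z$ whose image is mapped onto itself by $g$. An isometric action on $X$ induces an isometric action on $\hat X$. **Theorem.** Let $X$ be a geodesic metric space. 1. For every geodesic $\gamma: I\to X$, the parametrized image $\hat\gamma: I\to\hat X$ is a quasi-geodesic if and only if $\gamma$ is strongly contracting. 2. For every geodesic $\gamma:I\to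 X$ and every $x\in X$, if $p$ and $q$ are points on $\gamma$ closest to $x$ with respect to $d$ and $\hat d$ respectively, then $\hat d(p,q)<17$. 3. Let $G$ be a group acting by isometries on $X$ and let $g\in G$. If $g$ acts loxodromically on $\hat X$, then $g$ acts strongly-contracting on $X$. -/

import Mathlib

open Set Metric
open scoped ENNReal Pointwise

universe u v

noncomputable section

namespace Contraction

/-! ### Geodesics, closest points, quasi-geodesics, strong contraction -/

section Basic

variable {X : Type u} [MetricSpace X]

/-- The restriction of `γ` to the set `I` (an interval, in the applications) is a geodesic,
i.e. an isometric embedding of `I`. Values of `γ` outside `I` are irrelevant. -/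
def IsGeodesicOn (γ : ℝ → X) (I : Set ℝ) : Prop :=
  ∀ s ∈ I, ∀ t ∈ I, dist (γ s) (γ t) = |s - t|

/-- `S` is (the image of) a geodesic segment from `x` to `y`; its length is `dist x y`. -/
def IsGeodesicSegment (S : Set X) (x y : X) : Prop :=
  ∃ c : ℝ → X, c 0 = x ∧ c (dist x y) = y ∧ IsGeodesicOn c (Icc 0 (dist x y)) ∧
    S = c '' Icc 0 (dist x y)

/-- Any two points are joined by a geodesic segment. -/
def IsGeodesicSpace (X : Type u) [MetricSpace X] : Prop :=
  ∀ x y : X, ∃ S : Set X, IsGeodesicSegment S x y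

/-- The closest point projection `π_Y(x)`: the set of points of `Y` closest to `x`. -/
def closestPoints (Y : Set X) (x : X) : Set X :=
  {p | p ∈ Y ∧ ∀ p' ∈ Y, dist x p ≤ dist x p'}

/-- The set `Y` is `D`-contracting: for all `x`, the projection `π_Y` of the open ball
around `x` of radius `d(x, Y)` has diameter at most `D`. -/
def IsContracting (D : ℝ) (Y : Set X) : Prop :=
  0 ≤ D ∧ ∀ x : X,
    ediam (⋃ z ∈ ball x (infDist x Y), closestPoints Y z) ≤ ENNReal.ofReal D

/-- `Y` is strongly contracting. -/
def IsStronglyContracting (Y : Set X) : Prop :=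
  ∃ D : ℝ, IsContracting D Y

/-- The map `γ : I → X` is a `C`-quasi-geodesic. -/
def IsQuasiGeodesicOn (C : ℝ) (γ : ℝ → X) (I : Set ℝ) : Prop :=
  1 ≤ C ∧ ContinuousOn γ I ∧ ∀ s ∈ I, ∀ t ∈ I,
    |t - s| / C - C ≤ dist (γ s) (γ t) ∧ dist (γ s) (γ t) ≤ C * |t - s| + C

end Basic

/-! ### Loxodromic and strongly contracting elements -/

section Elements

variable {G : Type v} [Group G]

/-- `g` acts loxodromically on `X`: for some `x`, the orbit map `n ↦ gⁿ x` is a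
quasi-isometric embedding of `ℤ`. -/
def IsLoxodromic (g : G) (X : Type u) [MetricSpace X] [MulAction G X] : Prop :=
  ∃ x : X, ∃ C : ℝ, 1 ≤ C ∧ ∀ m n : ℤ,
    |(m : ℝ) - n| / C - C ≤ dist (g ^ m • x) (g ^ n • x) ∧
      dist (g ^ m • x) (g ^ n • x) ≤ C * |(m : ℝ) - n| + C

/-- `g` acts strongly-contracting on `X`: it is loxodromic and, for some `C`, it stabilizes
a bi-infinite `C`-contracting `C`-quasi-geodesic. -/
def IsStronglyContractingElement (g : G) (X : Type u) [MetricSpace X] [MulAction G X] : Prop :=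
  IsLoxodromic g X ∧ ∃ C : ℝ, ∃ c : ℝ → X,
    IsQuasiGeodesicOn C c univ ∧ IsContracting C (range c) ∧ g • range c = range c

end Elements

/-! ### Thin segments and anti-contracting pairs -/

section Thin

variable {X : Type u} [MetricSpace X]

/-- The geodesic segments `Q 0, Q 1, Q 2, Q 3`, with consecutive vertices
`w 0, w 1, w 2, w 3, w 0`, form a (possibly degenerate) geodesic quadrangle. -/
def IsQuadrangle (w : Fin 4 → X) (Q : Fin 4 → Set X) : Prop :=
  ∀ i : Fin 4, IsGeodesicSegment (Q i) (w i) (w (i + 1))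

/-- The geodesic segment `S` from `x` to `y` is `r`-thin: for each quadrangle whose first side
contains `S`, the union of the other three sides meets the closed `r`-ball around the midpoint
`m` of `S`. -/
def IsThin (r : ℝ) (S : Set X) (x y : X) : Prop :=
  ∀ (w : Fin 4 → X) (Q : Fin 4 → Set X), IsQuadrangle w Q → S ⊆ Q 0 →
    ∀ m ∈ S, dist m x = dist m y → ((Q 1 ∪ Q 2 ∪ Q 3) ∩ closedBall m r).Nonempty

/-- The contraction gauge `K(r) = 10 r + 1`. -/
def contractionGauge (r : ℝ) : ℝ := 10 * r + 1

/-- The pair `(x, y)` is anti-contracting: `d(x, y) ≥ 1`, and for no `r ≥ 0` does a geodesic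
from `x` to `y` have an `r`-thin subsegment of length at least `K(r)`. -/
def AntiContracting (x y : X) : Prop :=
  1 ≤ dist x y ∧ ∀ r : ℝ, 0 ≤ r → ∀ S : Set X, IsGeodesicSegment S x y →
    ∀ (S' : Set X) (x' y' : X), IsGeodesicSegment S' x' y' → S' ⊆ S →
      contractionGauge r ≤ dist x' y' → ¬ IsThin r S' x' y'

/-- The set of anti-contracting (ordered) pairs. -/
abbrev AntiPairs (X : Type u) [MetricSpace X] : Type u :=
  {a : X × X // AntiContracting a.1 a.2}

variable {G : Type v} [Group G] [MulAction G X] [IsIsometricSMul G X]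

theorem IsGeodesicSegment.smul (g : G) {S : Set X} {x y : X} (h : IsGeodesicSegment S x y) :
    IsGeodesicSegment (g • S) (g • x) (g • y) := by
  obtain ⟨c, h0, h1, hc, rfl⟩ := h
  refine ⟨fun t => g • c t, by simp [h0], by simp [dist_smul, h1], ?_, ?_⟩
  · intro s hs t ht
    rw [dist_smul] at hs ht
    simpa [dist_smul] using hc s hs t ht
  · rw [dist_smul, ← image_smul, image_image]

theorem IsThin.smul (g : G) {r : ℝ} {S : Set X} {x y : X} (h : IsThin r S x y) :
    IsThin r (g • S) (g • x) (g • y) := by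
  intro w Q hQ hS m hm hxy
  obtain ⟨m, hm, rfl⟩ := hm
  have hxy : dist (g • m) (g • x) = dist (g • m) (g • y) := hxy
  rw [dist_smul, dist_smul] at hxy
  have hsub : S ⊆ (g⁻¹ • Q 0 : Set X) := by
    rwa [← Set.smul_set_subset_iff_subset_inv_smul_set]
  obtain ⟨z, hz, hzm⟩ := h (fun i => g⁻¹ • w i) (fun i => g⁻¹ • Q i)
    (fun i => (hQ i).smul g⁻¹) hsub m hm hxy
  refine ⟨g • z, ?_, ?_⟩
  · simpa only [mem_union, Set.mem_inv_smul_set_iff] using hz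
  · show dist (g • z) (g • m) ≤ r
    rw [dist_smul]; exact hzm

theorem AntiContracting.smul (g : G) {x y : X} (h : AntiContracting x y) :
    AntiContracting (g • x) (g • y) := by
  refine ⟨by rw [dist_smul]; exact h.1, ?_⟩
  intro r hr S hS S' x' y' hS' hsub hl hthin
  refine h.2 r hr (g⁻¹ • S) ?_ (g⁻¹ • S') (g⁻¹ • x') (g⁻¹ • y') (hS'.smul g⁻¹)
    (Set.smul_set_mono hsub) (by rw [dist_smul]; exact hl) (hthin.smul g⁻¹)
  simpa using hS.smul g⁻¹

end Thin

/-! ### The contraction space -/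

section Space

/-- The disjoint union of `X` and of one copy of the interval `[0, 1]` for every
anti-contracting pair, before gluing. -/
inductive PreSpace (X : Type u) [MetricSpace X] : Type u
  | pt (x : X) : PreSpace X
  | edge (a : AntiPairs X) (s : Icc (0 : ℝ) 1) : PreSpace X

/-- `Chain p q l`: one can go from `p` to `q` with total length `l` by finitely many moves,
each of which is a move inside `X`, a move inside one of the added intervals (each with its
distance as cost), or a free move between glued points. The endpoint `0` of the interval of
a pair `(x, y)` is glued to `x`, the endpoint `1` to `y`. -/
inductive Chain {X : Type u} [MetricSpace X] : PreSpace X → PreSpace X → ℝ → Prop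
  | refl (p : PreSpace X) : Chain p p 0
  | inSpace (x y : X) : Chain (.pt x) (.pt y) (dist x y)
  | inEdge (a : AntiPairs X) (s t : Icc (0 : ℝ) 1) : Chain (.edge a s) (.edge a t) (dist s t)
  | source (a : AntiPairs X) : Chain (.edge a 0) (.pt a.1.1) 0
  | target (a : AntiPairs X) : Chain (.edge a 1) (.pt a.1.2) 0
  | symm {p q : PreSpace X} {l : ℝ} : Chain p q l → Chain q p l
  | trans {p q o : PreSpace X} {l l' : ℝ} : Chain p q l → Chain q o l' → Chain p o (l + l')

variable {X : Type u} [MetricSpace X]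

theorem Chain.nonneg {p q : PreSpace X} {l : ℝ} (h : Chain p q l) : 0 ≤ l := by
  induction h with
  | refl | source | target => exact le_rfl
  | inSpace | inEdge => exact dist_nonneg
  | symm _ ih => exact ih
  | trans _ _ ih ih' => exact add_nonneg ih ih'

theorem exists_chain (p q : PreSpace X) : ∃ l, Chain p q l := by
  have key : ∀ p : PreSpace X, ∃ x l, Chain p (.pt x) l := by
    rintro (x | ⟨a, s⟩)
    · exact ⟨x, _, .refl _⟩
    · exact ⟨a.1.1, _, (Chain.inEdge a s 0).trans (.source a)⟩
  obtain ⟨x, _, hx⟩ := key p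
  obtain ⟨y, _, hy⟩ := key q
  exact ⟨_, (hx.trans (.inSpace x y)).trans hy.symm⟩

theorem chain_bddBelow (p q : PreSpace X) : BddBelow {l | Chain p q l} :=
  ⟨0, fun _ h => h.nonneg⟩

/-- The path pseudo-metric: the infimum of the lengths of chains. -/
instance : PseudoMetricSpace (PreSpace X) where
  dist p q := sInf {l | Chain p q l}
  dist_self p := le_antisymm (csInf_le (chain_bddBelow p p) (.refl p))
    (le_csInf (exists_chain p p) fun _ h => h.nonneg)
  dist_comm p q := by
    congr 1
    ext l
    exact ⟨fun h => h.symm, fun h => h.symm⟩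
  dist_triangle p q o := by
    have h : ∀ l ∈ {l | Chain p q l}, ∀ l' ∈ {l | Chain q o l},
        sInf {l | Chain p o l} ≤ l + l' :=
      fun l hl l' hl' => csInf_le (chain_bddBelow p o) (hl.trans hl')
    have h' : ∀ l ∈ {l | Chain p q l},
        sInf {l | Chain p o l} - l ≤ sInf {l | Chain q o l} :=
      fun l hl => le_csInf (exists_chain q o) fun l' hl' => by linarith [h l hl l' hl']
    have h'' : sInf {l | Chain p o l} - sInf {l | Chain q o l} ≤ sInf {l | Chain p q l} :=
      le_csInf (exists_chain p q) fun l hl => by linarith [h' l hl]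
    linarith

/-- The contraction space `X̂` with its metric `d̂`. Identifying points at distance zero
performs exactly the gluing, because distinct points of the glued space have positive
distance. -/
abbrev ContractionSpace (X : Type u) [MetricSpace X] : Type u := SeparationQuotient (PreSpace X)

/-- The natural inclusion of `X` in its contraction space. -/
def incl (x : X) : ContractionSpace X := SeparationQuotient.mk (PreSpace.pt x)

/-! The action on the contraction space induced by an isometric action on `X`. -/

variable {G : Type v} [Group G] [MulAction G X] [IsIsometricSMul G X]

instance : MulAction G (PreSpace X) where
  smul g p := match p with
    | .pt x => .pt (g • x)
    | .edge a s => .edge ⟨(g • a.1.1, g • a.1.2), a.2.smul g⟩ s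
  one_smul := by
    rintro (x | ⟨⟨⟨x, y⟩, h⟩, s⟩)
    · exact congrArg PreSpace.pt (one_smul G x)
    · show PreSpace.edge ⟨((1 : G) • x, (1 : G) • y), _⟩ s = _
      congr <;> exact one_smul G _
  mul_smul g g' := by
    rintro (x | ⟨⟨⟨x, y⟩, h⟩, s⟩)
    · exact congrArg PreSpace.pt (mul_smul g g' x)
    · show PreSpace.edge ⟨((g * g') • x, (g * g') • y), _⟩ s =
        PreSpace.edge ⟨(g • g' • x, g • g' • y), _⟩ s
      congr 3 <;> exact mul_smul g g' _

theorem Chain.smul (g : G) {p q : PreSpace X} {l : ℝ} (h : Chain p q l) :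
    Chain (g • p) (g • q) l := by
  induction h with
  | refl p => exact .refl _
  | inSpace x y => rw [← dist_smul g x y]; exact .inSpace _ _
  | inEdge a s t => exact .inEdge _ s t
  | source a => exact .source ⟨(g • a.1.1, g • a.1.2), a.2.smul g⟩
  | target a => exact .target ⟨(g • a.1.1, g • a.1.2), a.2.smul g⟩
  | symm _ ih => exact ih.symm
  | trans _ _ ih ih' => exact ih.trans ih'

instance : IsIsometricSMul G (PreSpace X) where
  isometry_smul g := by
    refine Isometry.of_dist_eq fun p q => ?_
    show sInf {l | Chain (g • p) (g • q) l} = sInf {l | Chain p q l}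
    congr 1
    ext l
    exact ⟨fun h => by simpa using Chain.smul g⁻¹ h, fun h => h.smul g⟩

end Space

end Contraction

end

/-! Call a pair short if its points are at distance less than 1 or form an anti-contracting pair;
then their `hatDist` is at most 1. A pair that is not short is joined by some geodesic with a
bottleneck: a point `m`, at least `5 * r + 1 / 2` from both ends, such that in every quadrangle with
that geodesic on its first side another side comes within `r` of `m`.

Bottlenecks make geodesic triangles of X slim for `hatDist`. Let `y` be a point of two sides closest
to a point `z` of the third. If `(z, y)` were not short, the side of `z` would have to pass near the
bottleneck of `[z, y]` on either side of `z`, which no geodesic does (`isShort_of_closest`). Hence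
`visualSize m x y`, the supremum of 2 to the minus `hatDist m w` over `w` on geodesics from `x` to
`y`, satisfies f(x,z) ≤ 2 max(f(x,y), f(y,z)), and Frink's inequality bounds it by 4 times its sum
along any chain. A chain that avoids `m` for `hatDist` therefore forces the geodesics between its
ends to avoid `m`. This does the work of hyperbolicity, with explicit constants.

Closest points: if `hatDist p q` were at least 17, a bottleneck near `p` would put a point of a
geodesic from `x` to `q` within 1 of `m`, while an almost shortest route from `x` to `q` avoids `m`
too well (`Route.exists_isPathSum`).

Quasi-geodesic implies contracting, for any Lipschitz path `c` (`IsHatPath`): Frink's inequality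
keeps geodesics between points of `c` close to `c` for `hatDist`. So bottlenecks occur everywhere
along `c`, and comparing two consecutive ones bounds their size. A detour that projects far along
`c` would then have to pass near `c` midway, contradicting the choice of closest points. The same
statement, applied to an axis made of translates of a segment, handles loxodromic elements.

Contracting implies quasi-geodesic: the closest point projection is coarsely Lipschitz for `dist`
and bounded on anti-contracting pairs, because a geodesic with a large projection contains a long
thin subsegment. Hence it is coarsely Lipschitz for `hatDist`. -/

namespace Contraction

variable {X : Type u} [MetricSpace X]

/-! ### Geodesic segments: cutting, concatenating, replacing -/

namespace IsGeodesicSegment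

variable {S S' S₁ S₂ : Set X} {x y z u v w : X}

theorem of_geodesicOn {γ : ℝ → X} {a b : ℝ} (hab : a ≤ b) (h : IsGeodesicOn γ (Icc a b)) :
    IsGeodesicSegment (γ '' Icc a b) (γ a) (γ b) := by
  have hd : dist (γ a) (γ b) = b - a := by
    rw [h a ⟨le_rfl, hab⟩ b ⟨hab, le_rfl⟩, abs_sub_comm, abs_of_nonneg (by linarith)]
  refine ⟨fun t => γ (a + t), by simp, by simp [hd], ?_, ?_⟩
  · rintro s ⟨hs, hs'⟩ t ⟨ht, ht'⟩
    rw [hd] at hs' ht'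
    rw [h _ ⟨by linarith, by linarith⟩ _ ⟨by linarith, by linarith⟩]
    congr 1; ring
  · rw [hd]
    have := image_comp γ (fun t => a + t) (Icc 0 (b - a))
    rw [image_const_add_Icc] at this
    simpa [Function.comp_def] using this.symm

theorem symm (h : IsGeodesicSegment S x y) : IsGeodesicSegment S y x := by
  obtain ⟨c, h0, h1, hc, rfl⟩ := h
  refine ⟨fun t => c (dist x y - t), by simp [h1], by simp [dist_comm y x, h0], ?_, ?_⟩
  · rintro s ⟨hs, hs'⟩ t ⟨ht, ht'⟩
    rw [dist_comm y x] at hs' ht'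
    rw [hc _ ⟨by linarith, by linarith⟩ _ ⟨by linarith, by linarith⟩, abs_sub_comm]
    congr 1; ring
  · have := image_comp c (fun t => dist x y - t) (Icc 0 (dist x y))
    rw [image_const_sub_Icc] at this
    simpa [Function.comp_def, dist_comm y x] using this.symm

theorem left_mem (h : IsGeodesicSegment S x y) : x ∈ S := by
  obtain ⟨c, h0, h1, hc, rfl⟩ := h
  exact ⟨0, ⟨le_rfl, dist_nonneg⟩, h0⟩

theorem right_mem (h : IsGeodesicSegment S x y) : y ∈ S := h.symm.left_mem

theorem singleton (x : X) : IsGeodesicSegment {x} x x :=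
  ⟨fun _ => x, rfl, rfl, by
    rintro s ⟨hs, hs'⟩ t ⟨ht, ht'⟩
    rw [dist_self] at *
    rw [le_antisymm hs' hs, le_antisymm ht' ht]; simp, by simp⟩

theorem dist_eq_abs (h : IsGeodesicSegment S x y) (hu : u ∈ S) (hv : v ∈ S) :
    dist u v = |dist x u - dist x v| := by
  obtain ⟨c, h0, h1, hc, rfl⟩ := h
  obtain ⟨s, hs, rfl⟩ := hu
  obtain ⟨t, ht, rfl⟩ := hv
  have key : ∀ t ∈ Icc 0 (dist x y), dist x (c t) = t := fun t ht => by
    have := hc 0 ⟨le_rfl, dist_nonneg⟩ t ht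
    rw [h0] at this
    rw [this, zero_sub, abs_neg, abs_of_nonneg ht.1]
  rw [key s hs, key t ht, hc s hs t ht]

theorem dist_eq_sub (h : IsGeodesicSegment S x y) (hu : u ∈ S) (hv : v ∈ S)
    (huv : dist x u ≤ dist x v) : dist u v = dist x v - dist x u := by
  rw [h.dist_eq_abs hu hv, abs_sub_comm, abs_of_nonneg (by linarith)]

theorem dist_add_dist (h : IsGeodesicSegment S x y) (hu : u ∈ S) :
    dist x u + dist u y = dist x y := by
  have h1 : dist x u ≤ dist x y := by
    obtain ⟨c, h0, h1, hc, rfl⟩ := h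
    obtain ⟨s, hs, rfl⟩ := hu
    have := hc 0 ⟨le_rfl, dist_nonneg⟩ s hs
    rw [h0] at this
    rw [this, zero_sub, abs_neg, abs_of_nonneg hs.1]; exact hs.2
  rw [h.dist_eq_sub hu h.right_mem h1]; ring

theorem eq_of_dist_eq (h : IsGeodesicSegment S x y) (hu : u ∈ S) (hv : v ∈ S)
    (huv : dist x u = dist x v) : u = v :=
  dist_eq_zero.1 (by rw [h.dist_eq_sub hu hv huv.le]; linarith)

theorem exists_dist_eq (h : IsGeodesicSegment S x y) {t : ℝ} (h0 : 0 ≤ t) (h1 : t ≤ dist x y) :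
    ∃ u ∈ S, dist x u = t := by
  obtain ⟨c, hc0, hc1, hc, rfl⟩ := h
  refine ⟨c t, ⟨t, ⟨h0, h1⟩, rfl⟩, ?_⟩
  have := hc 0 ⟨le_rfl, dist_nonneg⟩ t ⟨h0, h1⟩
  rw [hc0] at this
  rw [this, zero_sub, abs_neg, abs_of_nonneg h0]

theorem isCompact (h : IsGeodesicSegment S x y) : IsCompact S := by
  obtain ⟨c, hc0, hc1, hc, rfl⟩ := h
  refine isCompact_Icc.image_of_continuousOn ?_
  have : LipschitzOnWith 1 c (Icc 0 (dist x y)) :=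
    LipschitzOnWith.of_dist_le_mul fun s hs t ht => by
      rw [hc s hs t ht, Real.dist_eq]; simp
  exact this.continuousOn

theorem exists_sub (h : IsGeodesicSegment S x y) (hu : u ∈ S) (hv : v ∈ S) :
    ∃ S' ⊆ S, IsGeodesicSegment S' u v := by
  obtain ⟨c, h0, h1, hc, rfl⟩ := h
  obtain ⟨s, hs, rfl⟩ := hu
  obtain ⟨t, ht, rfl⟩ := hv
  have key : ∀ s ∈ Icc 0 (dist x y), ∀ t ∈ Icc 0 (dist x y), s ≤ t →
      ∃ S' ⊆ c '' Icc 0 (dist x y), IsGeodesicSegment S' (c s) (c t) := fun s hs t ht hst =>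
    ⟨c '' Icc s t, image_mono (Icc_subset_Icc hs.1 ht.2),
      of_geodesicOn hst fun a ha b hb =>
        hc a (Icc_subset_Icc hs.1 ht.2 ha) b (Icc_subset_Icc hs.1 ht.2 hb)⟩
  rcases le_total s t with hst | hst
  · exact key s hs t ht hst
  · obtain ⟨S', hS', h'⟩ := key t ht s hs hst
    exact ⟨S', hS', h'.symm⟩

theorem dist_mem_Icc (h : IsGeodesicSegment S x y) (hS' : S' ⊆ S) (h' : IsGeodesicSegment S' u v)
    (huv : dist x u ≤ dist x v) (hw : w ∈ S') : dist x w ∈ Icc (dist x u) (dist x v) := by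
  have h1 := h'.dist_add_dist hw
  have hu := hS' h'.left_mem
  have hv := hS' h'.right_mem
  rw [h.dist_eq_sub hu hv huv, h.dist_eq_abs hu (hS' hw), h.dist_eq_abs (hS' hw) hv] at h1
  constructor
  · by_contra! hlt
    rw [abs_of_nonneg (by linarith), abs_of_nonpos (by linarith)] at h1
    linarith
  · by_contra! hlt
    rw [abs_of_nonpos (by linarith), abs_of_nonneg (by linarith)] at h1
    linarith

theorem mem_sub (h : IsGeodesicSegment S x y) (hS' : S' ⊆ S) (h' : IsGeodesicSegment S' u v)
    (hw : w ∈ S) (h1 : dist x u ≤ dist x w) (h2 : dist x w ≤ dist x v) : w ∈ S' := by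
  have hu := hS' h'.left_mem
  have hv := hS' h'.right_mem
  have huv := h.dist_eq_sub hu hv (h1.trans h2)
  obtain ⟨w', hw', hd⟩ := h'.exists_dist_eq (t := dist u w) dist_nonneg (by
    rw [h.dist_eq_sub hu hw h1, huv]; linarith)
  have h3 := (h.dist_mem_Icc hS' h' (h1.trans h2) hw').1
  rw [h.dist_eq_sub hu hw h1, h.dist_eq_sub hu (hS' hw') h3] at hd
  rwa [h.eq_of_dist_eq hw (hS' hw') (by linarith)]

theorem concat (h₁ : IsGeodesicSegment S₁ x y) (h₂ : IsGeodesicSegment S₂ y z)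
    (h : dist x y + dist y z = dist x z) : IsGeodesicSegment (S₁ ∪ S₂) x z := by
  obtain ⟨c₁, h10, h11, hc₁, rfl⟩ := h₁
  obtain ⟨c₂, h20, h21, hc₂, rfl⟩ := h₂
  set a := dist x y with ha
  set b := dist y z with hb
  have ha0 : 0 ≤ a := dist_nonneg
  have hb0 : 0 ≤ b := dist_nonneg
  set c : ℝ → X := fun t => if t ≤ a then c₁ t else c₂ (t - a) with hc
  have hl : ∀ t, t ≤ a → c t = c₁ t := fun t ht => if_pos ht
  have hr : ∀ t, a ≤ t → c t = c₂ (t - a) := fun t ht => by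
    rcases ht.eq_or_lt with rfl | ht
    · rw [hl _ le_rfl, h11, sub_self, h20]
    · exact if_neg (not_le.2 ht)
  have hcross : ∀ s ∈ Icc 0 a, ∀ t ∈ Icc a (a + b), dist (c s) (c t) = t - s := by
    intro s hs t ht
    have e1 : dist x (c s) = s := by
      rw [hl s hs.2, ← h10, hc₁ 0 ⟨le_rfl, ha0⟩ s hs, zero_sub, abs_neg, abs_of_nonneg hs.1]
    have e2 : dist (c s) y = a - s := by
      rw [hl s hs.2, ← h11, hc₁ s hs a ⟨ha0, le_rfl⟩, abs_sub_comm, abs_of_nonneg (by linarith [hs.2])]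
    have ht' : t - a ∈ Icc 0 b := ⟨by linarith [ht.1], by linarith [ht.2]⟩
    have e3 : dist y (c t) = t - a := by
      rw [hr t ht.1, ← h20, hc₂ 0 ⟨le_rfl, hb0⟩ _ ht', zero_sub, abs_neg, abs_of_nonneg ht'.1]
    have e4 : dist (c t) z = b - (t - a) := by
      rw [hr t ht.1, ← h21, hc₂ _ ht' b ⟨hb0, le_rfl⟩, abs_sub_comm,
        abs_of_nonneg (by linarith [ht'.2])]
    have t1 := dist_triangle (c s) y (c t)
    have t2 := dist_triangle4 x (c s) (c t) z
    linarith
  have hd : dist x z = a + b := h.symm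
  refine ⟨c, by rw [hl 0 ha0, h10], by
    rw [hd, hr _ (by linarith), add_sub_cancel_left, h21], ?_, ?_⟩
  · have key : ∀ s ∈ Icc 0 (a + b), ∀ t ∈ Icc 0 (a + b), s ≤ t → dist (c s) (c t) = |s - t| := by
      intro s hs t ht hst
      rw [abs_sub_comm, abs_of_nonneg (by linarith)]
      rcases le_total s a with hsa | hsa
      · rcases le_total t a with hta | hta
        · rw [hl s hsa, hl t hta, hc₁ s ⟨hs.1, hsa⟩ t ⟨ht.1, hta⟩, abs_sub_comm,
            abs_of_nonneg (by linarith)]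
        · exact hcross s ⟨hs.1, hsa⟩ t ⟨hta, ht.2⟩
      · rw [hr s hsa, hr t (hsa.trans hst), hc₂ _ ⟨by linarith, by linarith [hs.2]⟩ _
          ⟨by linarith, by linarith [ht.2]⟩, abs_sub_comm, abs_of_nonneg (by linarith)]
        ring
    rw [hd]
    intro s hs t ht
    rcases le_total s t with hst | hst
    · exact key s hs t ht hst
    · rw [dist_comm, abs_sub_comm, key t ht s hs hst]
  · rw [hd, ← Icc_union_Icc_eq_Icc ha0 (by linarith : a ≤ a + b), image_union]
    congr 1
    · exact image_congr fun t ht => (hl t ht.2).symm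
    · have e : Icc a (a + b) = (fun t => a + t) '' Icc 0 b := by
        rw [image_const_add_Icc, add_zero]
      rw [e, image_image]
      refine image_congr fun t ht => ?_
      rw [hr _ (by linarith [ht.1]), add_sub_cancel_left]

/-- Bottlenecks live on some geodesic between two points, not on a prescribed one; this inserts that
geodesic into a longer one. The last clause locates the points that were not replaced. -/
theorem exists_replace (h : IsGeodesicSegment S x y) (hu : u ∈ S) (hv : v ∈ S)
    (huv : dist x u ≤ dist x v) (h' : IsGeodesicSegment S' u v) :
    ∃ G, IsGeodesicSegment G x y ∧ S' ⊆ G ∧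
      ∀ w ∈ G, w ∈ S' ∨ w ∈ S ∧ (dist x w ≤ dist x u ∨ dist x v ≤ dist x w) := by
  obtain ⟨A, hA, hA'⟩ := h.exists_sub h.left_mem hu
  obtain ⟨B, hB, hB'⟩ := h.exists_sub hv h.right_mem
  have e1 := h.dist_add_dist hu
  have e2 := h.dist_add_dist hv
  have e3 := h.dist_eq_sub hu hv huv
  refine ⟨(A ∪ S') ∪ B, (hA'.concat h' (by linarith)).concat hB' (by linarith),
    fun w hw => .inl (.inr hw), ?_⟩
  rintro w ((hw | hw) | hw)
  · exact .inr ⟨hA hw, .inl (h.dist_mem_Icc hA hA' (by simp) hw).2⟩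
  · exact .inl hw
  · exact .inr ⟨hB hw, .inr (h.dist_mem_Icc hB hB' (by linarith [dist_nonneg (x := v) (y := y)]) hw).1⟩

theorem exists_closest (h : IsGeodesicSegment S x y) (z : X) :
    ∃ p ∈ S, ∀ q ∈ S, dist z p ≤ dist z q :=
  h.isCompact.exists_isMinOn (f := fun q => dist z q) ⟨x, h.left_mem⟩ (by fun_prop)

end IsGeodesicSegment

/-! ### Anti-contracting pairs, bottlenecks and slim triangles -/

open IsGeodesicSegment

theorem AntiContracting.symm {x y : X} (h : AntiContracting x y) : AntiContracting y x :=
  ⟨by rw [dist_comm]; exact h.1, fun r hr S hS => h.2 r hr S hS.symm⟩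

/-- Any geodesic from `u` to `v` can be inserted into `S`, so a thin subsegment of it would lie on a
geodesic from `x` to `y`. This is where quantifying over all geodesics in the definition matters. -/
theorem AntiContracting.mono {x y u v : X} {S : Set X} (h : AntiContracting x y)
    (hS : IsGeodesicSegment S x y) (hu : u ∈ S) (hv : v ∈ S) (huv : 1 ≤ dist u v) :
    AntiContracting u v := by
  have key : ∀ u ∈ S, ∀ v ∈ S, 1 ≤ dist u v → dist x u ≤ dist x v → AntiContracting u v := by
    intro u hu v hv huv hle
    refine ⟨huv, fun r hr S₁ hS₁ S' x' y' hS' hsub => ?_⟩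
    obtain ⟨G, hG, hSG, -⟩ := hS.exists_replace hu hv hle hS₁
    exact h.2 r hr G hG S' x' y' hS' (hsub.trans hSG)
  rcases le_total (dist x u) (dist x v) with hle | hle
  · exact key u hu v hv huv hle
  · exact (key v hv u hu (by rwa [dist_comm]) hle).symm

/-- The distance in the contraction space of two points of the original space. -/
noncomputable def hatDist (x y : X) : ℝ := dist (incl x) (incl y)

theorem hatDist_comm (x y : X) : hatDist x y = hatDist y x := dist_comm _ _

theorem hatDist_self (x : X) : hatDist x x = 0 := dist_self _

theorem hatDist_nonneg (x y : X) : 0 ≤ hatDist x y := dist_nonneg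

theorem hatDist_triangle (x y z : X) : hatDist x z ≤ hatDist x y + hatDist y z :=
  dist_triangle _ _ _

theorem dist_le_of_chain {p q : PreSpace X} {l : ℝ} (h : Chain p q l) : dist p q ≤ l :=
  csInf_le (chain_bddBelow p q) h

theorem hatDist_le_dist (x y : X) : hatDist x y ≤ dist x y := dist_le_of_chain (.inSpace x y)

theorem continuous_hatDist (x : X) : Continuous (hatDist x) := by
  have : LipschitzWith 1 (hatDist x) := LipschitzWith.of_le_add fun v w => by
    have := hatDist_triangle x w v
    have := hatDist_le_dist w v
    rw [dist_comm v w]; linarith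
  exact this.continuous

theorem AntiContracting.hatDist_le_one {x y : X} (h : AntiContracting x y) : hatDist x y ≤ 1 := by
  have h1 := ((Chain.source ⟨(x, y), h⟩).symm.trans (.inEdge ⟨(x, y), h⟩ 0 1)).trans
    (.target ⟨(x, y), h⟩)
  have h2 : dist (0 : Icc (0 : ℝ) 1) 1 = 1 := by
    rw [Subtype.dist_eq, Real.dist_eq]; norm_num
  have := dist_le_of_chain h1
  rw [h2] at this
  calc hatDist x y ≤ _ := this
    _ = 1 := by norm_num

/-- Pairs at distance less than `1` and anti-contracting pairs. -/
def IsShort (x y : X) : Prop := dist x y < 1 ∨ AntiContracting x y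

theorem IsShort.symm {x y : X} (h : IsShort x y) : IsShort y x :=
  h.imp (fun h => by rwa [dist_comm]) AntiContracting.symm

theorem IsShort.hatDist_le_one {x y : X} (h : IsShort x y) : hatDist x y ≤ 1 :=
  h.elim (fun h => (hatDist_le_dist x y).trans h.le) AntiContracting.hatDist_le_one

/-- Every quadrangle whose first side contains `S` has another side which meets the closed ball
of radius `r` around `m`. -/
def IsBottleneck (r : ℝ) (S : Set X) (m : X) : Prop :=
  ∀ ⦃a b c d : X⦄ ⦃G S₁ S₂ S₃ : Set X⦄, IsGeodesicSegment G a b → S ⊆ G →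
    IsGeodesicSegment S₁ b c → IsGeodesicSegment S₂ c d → IsGeodesicSegment S₃ d a →
      ∃ z, (z ∈ S₁ ∨ z ∈ S₂ ∨ z ∈ S₃) ∧ dist z m ≤ r

theorem IsThin.isBottleneck {r : ℝ} {S S' : Set X} {x y m : X} (h : IsThin r S x y) (hm : m ∈ S)
    (hxy : dist m x = dist m y) (hS : S ⊆ S') : IsBottleneck r S' m := by
  intro a b c d G S₁ S₂ S₃ hG hSG h₁ h₂ h₃
  obtain ⟨z, hz, hzm⟩ := h ![a, b, c, d] ![G, S₁, S₂, S₃]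
    (by intro i; fin_cases i <;> assumption) (hS.trans hSG) m hm hxy
  refine ⟨z, ?_, hzm⟩
  simpa [or_assoc] using hz

/-- Take the midpoint of a thin subsegment: half of the gauge `10 * r + 1` is the margin `5 * r + 1
/ 2` on each side. -/
theorem exists_isBottleneck {x y : X} (h : ¬ IsShort x y) :
    ∃ r, 0 ≤ r ∧ ∃ S m, IsGeodesicSegment S x y ∧ m ∈ S ∧ 5 * r + 1 / 2 ≤ dist x m ∧
      5 * r + 1 / 2 ≤ dist m y ∧ IsBottleneck r S m := by
  have h1 : 1 ≤ dist x y := not_lt.1 fun hlt => h (.inl hlt)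
  have h2 : ¬ AntiContracting x y := fun ha => h (.inr ha)
  simp only [AntiContracting, not_and, not_forall, not_not] at h2
  obtain ⟨r, hr, S, hS, S', x', y', hS', hsub, hl, hthin⟩ := h2 h1
  unfold contractionGauge at hl
  obtain ⟨m, hm, hd⟩ := hS'.exists_dist_eq (t := dist x' y' / 2) (by positivity)
    (by linarith [dist_nonneg (x := x') (y := y')])
  have hd' : dist m y' = dist x' y' / 2 := by linarith [hS'.dist_add_dist hm]
  have key : ∀ x' y', IsGeodesicSegment S' x' y' → dist x' m = dist x' y' / 2 →
      dist m y' = dist x' y' / 2 → dist x x' ≤ dist x y' →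
      dist x' y' / 2 ≤ dist x m ∧ dist x' y' / 2 ≤ dist m y := by
    intro x' y' hS' e1 e2 hle
    have hm' := hS.dist_mem_Icc hsub hS' hle hm
    have e3 := hS.dist_eq_sub (hsub hS'.left_mem) (hsub hm) hm'.1
    have e4 := hS.dist_eq_sub (hsub hm) (hsub hS'.right_mem) hm'.2
    have e5 := hS.dist_add_dist (hsub hm)
    have e6 := hS.dist_add_dist (hsub hS'.right_mem)
    have := dist_nonneg (x := x) (y := x')
    have := dist_nonneg (x := y') (y := y)
    constructor <;> linarith
  have h3 : dist x' y' / 2 ≤ dist x m ∧ dist x' y' / 2 ≤ dist m y := by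
    rcases le_total (dist x x') (dist x y') with hle | hle
    · exact key x' y' hS' hd hd' hle
    · rw [dist_comm x' y']
      exact key y' x' hS'.symm (by rw [dist_comm, hd', dist_comm]) (by rw [dist_comm, hd, dist_comm])
        hle
  exact ⟨r, hr, S, m, hS, hsub hm, by linarith, by linarith,
    hthin.isBottleneck hm (by rw [hd', dist_comm, hd]) hsub⟩

/-- A bottleneck `m` on `[z, y]` is farther than `r` from `S₂ ∪ S₃`, since a point there would be
closer to `z` than `y`. Completing `[z, y]` to quadrangles through `b` and through `c`, `a` thus
puts points of both `[b, z]` and `[a, z]` within `r` of `m`. These are `2 * r`-close to each other,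
yet on opposite sides of `z` and each more than `4 * r` away from it. -/
theorem isShort_of_closest_aux {a b c z y : X} {S₁ S₂ S₃ : Set X} (h₁ : IsGeodesicSegment S₁ a b)
    (h₂ : IsGeodesicSegment S₂ b c) (h₃ : IsGeodesicSegment S₃ c a) (hz : z ∈ S₁) (hy : y ∈ S₂)
    (hmin : ∀ y' ∈ S₂ ∪ S₃, dist z y ≤ dist z y') : IsShort z y := by
  by_contra hns
  obtain ⟨r, hr, S, m, hS, hm, hzm, hmy, hB⟩ := exists_isBottleneck hns
  have hadd := hS.dist_add_dist hm
  have far : ∀ u ∈ S₂ ∪ S₃, ¬ dist u m ≤ r := fun u hu hum => by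
    have := hmin u hu
    have := dist_triangle z m u
    rw [dist_comm m u] at this
    linarith
  obtain ⟨B₁, hB₁, sB₁⟩ := h₂.exists_sub hy h₂.left_mem
  obtain ⟨B₂, hB₂, sB₂⟩ := h₁.exists_sub h₁.right_mem hz
  obtain ⟨B₃, hB₃, sB₃⟩ := h₂.exists_sub hy h₂.right_mem
  obtain ⟨B₄, hB₄, sB₄⟩ := h₁.exists_sub h₁.left_mem hz
  obtain ⟨u, hu, hum⟩ : ∃ u ∈ B₂, dist u m ≤ r := by
    obtain ⟨u, hu | hu | hu, hum⟩ := hB hS Subset.rfl sB₁ (singleton b) sB₂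
    · exact absurd hum (far u (.inl (hB₁ hu)))
    · exact absurd hum (far u (.inl (by rw [mem_singleton_iff.1 hu]; exact h₂.left_mem)))
    · exact ⟨u, hu, hum⟩
  obtain ⟨v, hv, hvm⟩ : ∃ v ∈ B₄, dist v m ≤ r := by
    obtain ⟨v, hv | hv | hv, hvm⟩ := hB hS Subset.rfl sB₃ h₃ sB₄
    · exact absurd hvm (far v (.inl (hB₃ hv)))
    · exact absurd hvm (far v (.inr hv))
    · exact ⟨v, hv, hvm⟩
  have e1 := h₁.dist_add_dist hz
  have e2 := sB₂.dist_add_dist hu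
  have e3 := sB₄.dist_add_dist hv
  have t1 := dist_triangle4 a v u b
  have t2 := dist_triangle v m u
  have t3 := dist_triangle z u m
  have t4 := dist_triangle z v m
  rw [dist_comm m u] at t2
  rw [dist_comm b u, dist_comm b z, dist_comm u z] at e2
  rw [dist_comm v z] at e3
  linarith

/-- A closest point on the union of two sides of a geodesic triangle to a point of the third
side forms a short pair with it. -/
theorem isShort_of_closest {a b c z y : X} {S₁ S₂ S₃ : Set X} (h₁ : IsGeodesicSegment S₁ a b)
    (h₂ : IsGeodesicSegment S₂ b c) (h₃ : IsGeodesicSegment S₃ c a) (hz : z ∈ S₁)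
    (hy : y ∈ S₂ ∪ S₃) (hmin : ∀ y' ∈ S₂ ∪ S₃, dist z y ≤ dist z y') : IsShort z y := by
  rcases hy with hy | hy
  · exact isShort_of_closest_aux h₁ h₂ h₃ hz hy hmin
  · exact isShort_of_closest_aux h₁.symm h₃.symm h₂.symm hz hy (by rwa [union_comm])

/-- Slimness for `hatDist`, with a witness that is also closest for `dist`: a bottleneck at `z` then
makes the same witness close to `z` for both metrics. -/
theorem exists_closest_triangle {a b c : X} {S₁ S₂ S₃ : Set X} (h₁ : IsGeodesicSegment S₁ a b)
    (h₂ : IsGeodesicSegment S₂ b c) (h₃ : IsGeodesicSegment S₃ c a) {z : X} (hz : z ∈ S₁) :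
    ∃ y ∈ S₂ ∪ S₃, (∀ y' ∈ S₂ ∪ S₃, dist z y ≤ dist z y') ∧ hatDist z y ≤ 1 := by
  obtain ⟨y, hy, hmin⟩ := (h₂.isCompact.union h₃.isCompact).exists_isMinOn
    (f := fun y => dist z y) ⟨b, .inl h₂.left_mem⟩ (by fun_prop)
  exact ⟨y, hy, hmin, (isShort_of_closest h₁ h₂ h₃ hz hy hmin).hatDist_le_one⟩

theorem exists_hatDist_le_one_bigon {a b : X} {S₁ S₂ : Set X} (h₁ : IsGeodesicSegment S₁ a b)
    (h₂ : IsGeodesicSegment S₂ a b) {z : X} (hz : z ∈ S₁) : ∃ y ∈ S₂, hatDist z y ≤ 1 := by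
  obtain ⟨y, hy | hy, -, h⟩ := exists_closest_triangle h₁ h₂.symm (singleton a) hz
  · exact ⟨y, hy, h⟩
  · exact ⟨y, by rw [mem_singleton_iff.1 hy]; exact h₂.left_mem, h⟩

/-- A long segment (for the metric of the contraction space) has an initial part of moderate
size. -/
theorem exists_initial_part {x y : X} {S : Set X} (h : IsGeodesicSegment S x y)
    (hxy : 3 / 2 ≤ hatDist x y) :
    ∃ u ∈ S, 3 / 2 ≤ hatDist x u ∧ ∀ v ∈ S, dist x v ≤ dist x u → hatDist x v ≤ 2 := by
  have hcpt : IsCompact (S ∩ {v | 3 / 2 ≤ hatDist x v}) :=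
    h.isCompact.inter_right (isClosed_le continuous_const (continuous_hatDist x))
  obtain ⟨u, ⟨hu, hu'⟩, hmin⟩ := hcpt.exists_isMinOn (f := fun v => dist x v)
    ⟨y, h.right_mem, hxy⟩ (by fun_prop)
  have hlt : ∀ v ∈ S, dist x v < dist x u → hatDist x v < 3 / 2 := fun v hv hvu => by
    by_contra! hge
    have : dist x u ≤ dist x v := hmin ⟨hv, hge⟩
    linarith
  -- Step back by 1/2 along `S`, before the first point at `hatDist` at least 3/2.
  have hu2 : hatDist x u ≤ 2 := by
    have h0 : 3 / 2 ≤ dist x u := le_trans hu' (hatDist_le_dist x u)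
    obtain ⟨v, hv, hd⟩ := h.exists_dist_eq (t := dist x u - 1 / 2) (by linarith)
      (by linarith [h.dist_add_dist hu, dist_nonneg (x := u) (y := y)])
    have h1 := hlt v hv (by linarith)
    have h2 := hatDist_triangle x v u
    have h3 := hatDist_le_dist v u
    rw [h.dist_eq_sub hv hu (by linarith)] at h3
    linarith
  refine ⟨u, hu, hu', fun v hv hvu => ?_⟩
  rcases hvu.eq_or_lt with he | hlt'
  · rwa [h.eq_of_dist_eq hv hu he]
  · linarith [hlt v hv hlt']

end Contraction

/-! ### Frink's inequality -/

namespace Contraction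

/-- Frink's chain inequality, for chains of at least two steps, with the midpoints of the
consecutive intervals of lengths `f (u i) (u (i + 1))` on the right hand side. -/
theorem frink_aux {α : Type*} {f : α → α → ℝ} (h0 : ∀ x y, 0 ≤ f x y)
    (h : ∀ x y z, f x z ≤ 2 * max (f x y) (f y z)) (u : ℕ → α) (c : ℕ → ℝ)
    (hc : ∀ i, c (i + 1) - c i = (f (u i) (u (i + 1)) + f (u (i + 1)) (u (i + 2))) / 2)
    (n : ℕ) : ∀ a, f (u a) (u (a + n + 2)) ≤ 4 * (c (a + n + 1) - c a) := by
  have hmono : Monotone c := monotone_nat_of_le_succ fun i => by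
    linarith [hc i, h0 (u i) (u (i + 1)), h0 (u (i + 1)) (u (i + 2))]
  induction n using Nat.strong_induction_on with
  | _ n ih =>
  intro a
  set L := c (a + n + 1) - c a with hL
  have hL0 : 0 ≤ L := sub_nonneg.2 (hmono (by omega))
  -- the first index on the right of the middle
  have hex : ∃ k, c a + L / 2 ≤ c (a + k + 1) := ⟨n, by linarith⟩
  classical
  set k := Nat.find hex with hk
  have hk1 : c a + L / 2 ≤ c (a + k + 1) := Nat.find_spec hex
  have hkn : k ≤ n := Nat.find_min' hex (by linarith)
  have hk2 : c (a + k) ≤ c a + L / 2 := by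
    rcases Nat.eq_zero_or_pos k with h0 | h0
    · rw [h0, add_zero]; linarith
    · have := Nat.find_min hex (show k - 1 < k by omega)
      rw [not_le, show a + (k - 1) + 1 = a + k by omega] at this
      exact this.le
  -- The midpoints of the part before `u (a + k + 1)`, and likewise of the part after, span at most
  -- `L / 2`. A part reduced to one step has no span, but half of that step is contained in `L`.
  have left : f (u a) (u (a + k + 1)) ≤ 2 * L := by
    rcases Nat.eq_zero_or_pos k with hk0 | hk0
    · have h1 := hc a
      have h2 : c (a + 1) ≤ c (a + n + 1) := hmono (by omega)
      rw [hk0, add_zero]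
      linarith [h0 (u (a + 1)) (u (a + 2))]
    · have := ih (k - 1) (by omega) a
      rw [show a + (k - 1) + 2 = a + k + 1 by omega, show a + (k - 1) + 1 = a + k by omega] at this
      linarith
  have right : f (u (a + k + 1)) (u (a + n + 2)) ≤ 2 * L := by
    rcases hkn.eq_or_lt with hk0 | hk0
    · rw [hk0]
      have h1 := hc (a + n)
      have h2 : c a ≤ c (a + n) := hmono (by omega)
      linarith [h0 (u (a + n)) (u (a + n + 1))]
    · have := ih (n - k - 1) (by omega) (a + k + 1)
      rw [show a + k + 1 + (n - k - 1) + 2 = a + n + 2 by omega,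
        show a + k + 1 + (n - k - 1) + 1 = a + n + 1 by omega] at this
      linarith
  have := h (u a) (u (a + k + 1)) (u (a + n + 2))
  have := max_le left right
  linarith

/-- Frink's chain inequality. -/
theorem frink {α : Type*} {f : α → α → ℝ} (h0 : ∀ x y, 0 ≤ f x y)
    (h : ∀ x y z, f x z ≤ 2 * max (f x y) (f y z)) (u : ℕ → α) (n : ℕ) :
    f (u 0) (u (n + 1)) ≤ 4 * ∑ i ∈ Finset.range (n + 1), f (u i) (u (i + 1)) := by
  rcases n with _ | n
  · simp; linarith [h0 (u 0) (u 1)]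
  set g : ℕ → ℝ := fun i => f (u i) (u (i + 1)) with hg
  set c : ℕ → ℝ := fun i => ∑ j ∈ Finset.range i, g j + g i / 2 with hc
  have key := frink_aux h0 h u c (fun i => by
    simp only [hc, Finset.sum_range_succ]; simp only [hg]; ring) n 0
  have e : ∑ i ∈ Finset.range (n + 1 + 1), g i = c (n + 1) + g (n + 1) / 2 := by
    simp only [hc, Finset.sum_range_succ]; ring
  rw [e]
  have h1 : 0 ≤ g (n + 1) := h0 _ _
  have h2 : c 0 = g 0 / 2 := by simp [hc]
  have h3 : 0 ≤ g 0 := h0 _ _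
  simp only [zero_add] at key
  linarith

section

variable {X : Type*}

/-- `IsPathSum f x y s`: `s` is the sum of the values of `f` along a sequence of at least one
step from `x` to `y`. -/
def IsPathSum (f : X → X → ℝ) (x y : X) (s : ℝ) : Prop :=
  ∃ (u : ℕ → X) (n : ℕ), u 0 = x ∧ u (n + 1) = y ∧
    ∑ i ∈ Finset.range (n + 1), f (u i) (u (i + 1)) = s

theorem IsPathSum.single (f : X → X → ℝ) (x y : X) : IsPathSum f x y (f x y) :=
  ⟨fun i => if i = 0 then x else y, 0, by simp, by simp, by simp⟩

theorem IsPathSum.cons {f : X → X → ℝ} {x y z : X} {s : ℝ} (h : IsPathSum f y z s) :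
    IsPathSum f x z (f x y + s) := by
  obtain ⟨u, n, h0, h1, rfl⟩ := h
  refine ⟨fun i => Nat.casesOn i x u, n + 1, rfl, h1, ?_⟩
  rw [Finset.sum_range_succ', add_comm]
  simp [h0]

end

/-! ### Visual size, routes, and comparison of closest points -/

variable {X : Type u} [MetricSpace X]

/-- The supremum of `2 ^ (-d̂(m, w))` over the points `w` of the geodesics from `x` to `y`. -/
noncomputable def visualSize (m x y : X) : ℝ :=
  sSup {a | ∃ S w, IsGeodesicSegment S x y ∧ w ∈ S ∧ a = (2 : ℝ) ^ (-hatDist m w)}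

theorem visualSize_bddAbove (m x y : X) :
    BddAbove {a | ∃ S w, IsGeodesicSegment S x y ∧ w ∈ S ∧ a = (2 : ℝ) ^ (-hatDist m w)} :=
  ⟨1, by
    rintro _ ⟨S, w, -, -, rfl⟩
    exact Real.rpow_le_one_of_one_le_of_nonpos one_le_two (by linarith [hatDist_nonneg m w])⟩

theorem le_visualSize {m x y w : X} {S : Set X} (hS : IsGeodesicSegment S x y) (hw : w ∈ S) :
    (2 : ℝ) ^ (-hatDist m w) ≤ visualSize m x y :=
  le_csSup (visualSize_bddAbove m x y) ⟨S, w, hS, hw, rfl⟩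

theorem visualSize_nonneg (m x y : X) : 0 ≤ visualSize m x y :=
  Real.sSup_nonneg (by rintro _ ⟨S, w, -, -, rfl⟩; positivity)

theorem visualSize_le {m x y : X} {b : ℝ} (hb : ∀ S, IsGeodesicSegment S x y → ∀ w ∈ S,
    b ≤ hatDist m w) : visualSize m x y ≤ (2 : ℝ) ^ (-b) :=
  Real.sSup_le (by
    rintro _ ⟨S, w, hS, hw, rfl⟩
    exact Real.rpow_le_rpow_of_exponent_le one_le_two (by linarith [hb S hS w hw]))
    (by positivity)

/-- Slim triangles with constant 1 cost one factor of 2. -/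
theorem visualSize_triangle (hX : IsGeodesicSpace X) (m x y z : X) :
    visualSize m x z ≤ 2 * max (visualSize m x y) (visualSize m y z) := by
  refine Real.sSup_le ?_ (by
    have := visualSize_nonneg m x y
    have := le_max_left (visualSize m x y) (visualSize m y z)
    linarith)
  rintro _ ⟨S, w, hS, hw, rfl⟩
  obtain ⟨A, hA⟩ := hX x y
  obtain ⟨B, hB⟩ := hX y z
  obtain ⟨v, hv, -, hvw⟩ := exists_closest_triangle hS hB.symm hA.symm hw
  have h1 : (2 : ℝ) ^ (-hatDist m w) ≤ 2 * (2 : ℝ) ^ (-hatDist m v) := by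
    have : (2 : ℝ) * (2 : ℝ) ^ (-hatDist m v) = (2 : ℝ) ^ (1 + -hatDist m v) := by
      rw [Real.rpow_add two_pos, Real.rpow_one]
    rw [this]
    refine Real.rpow_le_rpow_of_exponent_le one_le_two ?_
    linarith [hatDist_triangle m w v]
  refine h1.trans (mul_le_mul_of_nonneg_left ?_ zero_le_two)
  rcases hv with hv | hv
  · exact (le_visualSize hB hv).trans (le_max_right _ _)
  · exact (le_visualSize hA hv).trans (le_max_left _ _)

/-- `Route q y t`: one can go from `y` to `q` with total cost `t`, by moves inside the space
alternating with jumps, at cost `1`, along anti-contracting pairs. -/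
inductive Route (q : X) : X → ℝ → Prop
  | last (y : X) : Route q y (dist y q)
  | leg {y y' y'' : X} {t : ℝ} (h : AntiContracting y' y'') (ht : Route q y'' t) :
      Route q y (dist y y' + 1 + t)

theorem Route.nonneg {q y : X} {t : ℝ} (h : Route q y t) : 0 ≤ t := by
  induction h with
  | last => exact dist_nonneg
  | leg _ _ ih => positivity

theorem Route.exists_le {q y z : X} {t : ℝ} (h : Route q y t) :
    ∃ t' ≤ dist z y + t, Route q z t' := by
  cases h with
  | last => exact ⟨_, dist_triangle _ _ _, .last z⟩
  | @leg _ y' _ t h ht => exact ⟨_, by linarith [dist_triangle z y y'], .leg h ht⟩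

/-- Bounding the metric of the contraction space from below. -/
theorem abs_sub_le_hatDist {F : X → ℝ} (h1 : ∀ x y, |F x - F y| ≤ dist x y)
    (h2 : ∀ x y, AntiContracting x y → |F x - F y| ≤ 1) (x y : X) :
    |F x - F y| ≤ hatDist x y := by
  -- On an added interval, the minimum of the two slope-one extensions from its ends is 1-Lipschitz
  -- and, by `h2`, agrees with `F` at both ends.
  set E : PreSpace X → ℝ := fun p => match p with
    | .pt x => F x
    | .edge a s => min (F a.1.1 + s) (F a.1.2 + (1 - s)) with hE
  have key : ∀ {p q : PreSpace X} {l : ℝ}, Chain p q l → |E p - E q| ≤ l := by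
    intro p q l h
    induction h with
    | refl p => simp
    | inSpace x y => exact h1 x y
    | inEdge a s t =>
      rw [Subtype.dist_eq, Real.dist_eq]
      refine (abs_min_sub_min_le_max _ _ _ _).trans (max_le ?_ ?_)
      · rw [add_sub_add_left_eq_sub]
      · rw [add_sub_add_left_eq_sub, sub_sub_sub_cancel_left, abs_sub_comm]
    | source a =>
      have := abs_le.1 (h2 _ _ a.2)
      have e : min (F a.1.1 + ((0 : Icc (0 : ℝ) 1) : ℝ)) (F a.1.2 + (1 - ((0 : Icc (0 : ℝ) 1) : ℝ)))
          = F a.1.1 := by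
        rw [min_eq_left] <;> simp; linarith
      simp only [hE]; rw [e]; simp
    | target a =>
      have := abs_le.1 (h2 _ _ a.2)
      have e : min (F a.1.1 + ((1 : Icc (0 : ℝ) 1) : ℝ)) (F a.1.2 + (1 - ((1 : Icc (0 : ℝ) 1) : ℝ)))
          = F a.1.2 := by
        rw [min_eq_right] <;> simp; linarith
      simp only [hE]; rw [e]; simp
    | symm _ ih => rwa [abs_sub_comm]
    | trans _ _ ih ih' => exact (abs_sub_le _ _ _).trans (add_le_add ih ih')
  exact le_csInf (exists_chain _ _) fun l hl => key hl

/-- The infimum of the route costs to `q` is 1-Lipschitz and varies by at most 1 along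
anti-contracting pairs, so it is bounded by `hatDist`. Arbitrary chains need not be normalised by
hand. -/
theorem exists_route (x q : X) {ε : ℝ} (hε : 0 < ε) : ∃ t < hatDist x q + ε, Route q x t := by
  set F : X → ℝ := fun y => sInf {t | Route q y t} with hF
  have hne : ∀ y, {t | Route q y t}.Nonempty := fun y => ⟨_, .last y⟩
  have hbdd : ∀ y, BddBelow {t | Route q y t} := fun y => ⟨0, fun t ht => ht.nonneg⟩
  have step : ∀ x y l, (∀ t, Route q y t → ∃ t' ≤ l + t, Route q x t') → F x ≤ F y + l := by
    intro x y l h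
    rw [← sub_le_iff_le_add]
    refine le_csInf (hne y) fun t ht => ?_
    obtain ⟨t', ht', hr⟩ := h t ht
    linarith [csInf_le (hbdd x) hr]
  have h1 : ∀ x y, F x ≤ F y + dist x y := fun x y => step x y _ fun t ht => ht.exists_le
  have h2 : ∀ x y, AntiContracting x y → F x ≤ F y + 1 := fun x y h => step x y _ fun t ht =>
    ⟨_, by rw [dist_self, zero_add], Route.leg (y := x) h ht⟩
  have key := abs_sub_le_hatDist (F := F)
    (fun x y => abs_sub_le_iff.2 ⟨by linarith [h1 x y], by linarith [h1 y x, dist_comm x y]⟩)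
    (fun x y h => abs_sub_le_iff.2 ⟨by linarith [h2 x y h], by linarith [h2 y x h.symm]⟩) x q
  have hq : F q ≤ 0 := csInf_le (hbdd q) (by simpa using Route.last (q := q) q)
  have : F x < hatDist x q + ε := by linarith [(abs_le.1 key).2]
  obtain ⟨t, ht, hlt⟩ := exists_lt_of_csInf_lt (hne x) this
  exact ⟨t, hlt, ht⟩

theorem IsPathSum.visualSize_le (hX : IsGeodesicSpace X) {m x y : X} {s : ℝ}
    (h : IsPathSum (visualSize m) x y s) : visualSize m x y ≤ 4 * s := by
  obtain ⟨u, n, rfl, rfl, rfl⟩ := h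
  exact frink (visualSize_nonneg m) (visualSize_triangle hX m) u n

theorem rpow_two_succ (a : ℝ) : (2 : ℝ) ^ (a + 1) = 2 * 2 ^ a := by
  rw [Real.rpow_add two_pos, Real.rpow_one, mul_comm]

theorem Route.hatDist_le {q y : X} {t : ℝ} (h : Route q y t) : hatDist y q ≤ t := by
  induction h with
  | last y => exact hatDist_le_dist y q
  | @leg y y' y'' t h _ ih =>
    linarith [hatDist_triangle y y' q, hatDist_triangle y' y'' q, hatDist_le_dist y y',
      h.hatDist_le_one]

theorem AntiContracting.hatDist_le_one_of_mem {x y w : X} {S : Set X} (h : AntiContracting x y)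
    (hS : IsGeodesicSegment S x y) (hw : w ∈ S) : hatDist x w ≤ 1 := by
  rcases lt_or_ge (dist x w) 1 with h1 | h1
  · exact (hatDist_le_dist x w).trans h1.le
  · exact (h.mono hS hS.left_mem hw h1).hatDist_le_one

/-- Along a route from `y` to `q` of cost `t`, whose points at remaining cost `s` have
distance at least `max (s - 1.1) (14 - s)` from `m`, the visual sizes have small sum. -/
theorem Route.exists_isPathSum {m q y : X} {t : ℝ} (h : Route q y t) (hN : 14 ≤ hatDist m q)
    (hy : t - 11 / 10 ≤ hatDist m y) : ∃ s, IsPathSum (visualSize m) y q s ∧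
      (t ≤ 8 → s ≤ (2 : ℝ) ^ (t - 12)) ∧ (7 ≤ t → s ≤ 15 / 128 - 7 * (2 : ℝ) ^ (-t)) := by
  have pow_le : ∀ {a b : ℝ}, a ≤ b → (2 : ℝ) ^ a ≤ (2 : ℝ) ^ b :=
    fun hab => Real.rpow_le_rpow_of_exponent_le one_le_two hab
  have pow_pos : ∀ a : ℝ, (0 : ℝ) < (2 : ℝ) ^ a := fun a => by positivity
  have pow_nat : ∀ (n : ℕ), (2 : ℝ) ^ (-(n : ℝ)) = 1 / 2 ^ n := fun n => by
    rw [Real.rpow_neg two_pos.le, Real.rpow_natCast, one_div]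
  -- The two bounds meet here: on [7, 8] the first is at most 1/16 = 15/128 - 7/128.
  have second : ∀ {t s : ℝ}, 7 ≤ t → s ≤ (2 : ℝ) ^ (t - 12) → t ≤ 8 →
      s ≤ 15 / 128 - 7 * (2 : ℝ) ^ (-t) := by
    intro t s h7 hs h8
    have h1 : (2 : ℝ) ^ (t - 12) ≤ (2 : ℝ) ^ (-((4 : ℕ) : ℝ)) := pow_le (by push_cast; linarith)
    have h2 : (2 : ℝ) ^ (-t) ≤ (2 : ℝ) ^ (-((7 : ℕ) : ℝ)) := pow_le (by push_cast; linarith)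
    rw [pow_nat] at h1 h2
    norm_num at h1 h2
    linarith
  -- A point at remaining cost τ is at `hatDist` at least τ - 1.1 from `m`, seen from the start, and
  -- at least 14 - τ, seen from `q`. The larger of these is always at least 6.45, whence the uniform
  -- exponent 6.
  have inside : ∀ {x z : X} {t t' : ℝ}, t - 11 / 10 ≤ hatDist m x → hatDist z q ≤ t' →
      t = dist x z + t' → visualSize m x z ≤ (2 : ℝ) ^ (t - 14) ∧
        visualSize m x z ≤ (2 : ℝ) ^ (-((6 : ℕ) : ℝ)) ∧
        visualSize m x z ≤ (2 : ℝ) ^ (11 / 10 - t') := by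
    intro x z t t' hx hz ht
    have key : ∀ S, IsGeodesicSegment S x z → ∀ w ∈ S, ∃ τ ∈ Icc t' t,
        τ - 11 / 10 ≤ hatDist m w ∧ 14 - τ ≤ hatDist m w := by
      intro S hS w hw
      have h1 := hS.dist_add_dist hw
      have h2 := hatDist_triangle m w x
      have h3 := hatDist_triangle m w q
      have h4 := hatDist_triangle w z q
      have h5 := hatDist_le_dist w z
      have h6 := hatDist_le_dist w x
      have h7 := dist_nonneg (x := x) (y := w)
      have h8 := dist_nonneg (x := w) (y := z)
      rw [dist_comm w x] at h6
      exact ⟨dist w z + t', ⟨by linarith, by linarith⟩, by linarith, by linarith⟩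
    refine ⟨(visualSize_le (b := 14 - t) fun S hS w hw => ?_).trans (pow_le (by linarith)),
      visualSize_le fun S hS w hw => ?_,
      (visualSize_le (b := t' - 11 / 10) fun S hS w hw => ?_).trans (pow_le (by linarith))⟩ <;>
    · obtain ⟨τ, hτ, h1, h2⟩ := key S hS w hw
      push_cast
      linarith [hτ.1, hτ.2]
  induction h with
  | last y =>
    obtain ⟨h1, h2, -⟩ := inside hy (by rw [hatDist_self]) (add_zero _).symm
    have h3 : visualSize m y q ≤ (2 : ℝ) ^ (dist y q - 12) := h1.trans (pow_le (by linarith))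
    refine ⟨_, .single _ _ _, fun _ => h3, fun h7 => ?_⟩
    rcases le_total (dist y q) 8 with h8 | h8
    · exact second h7 h3 h8
    · have h4 : (2 : ℝ) ^ (-dist y q) ≤ (2 : ℝ) ^ (-((8 : ℕ) : ℝ)) :=
        pow_le (by push_cast; linarith)
      rw [pow_nat] at h2 h4
      norm_num at h2 h4
      linarith
  | @leg y y' y'' t'' h hr ih =>
    have d0 := dist_nonneg (x := y) (y := y')
    have d1 := hatDist_triangle m y' y
    have d2 := hatDist_le_dist y' y
    rw [dist_comm y' y] at d2
    have d3 := hatDist_triangle m y'' y'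
    have d4 := h.symm.hatDist_le_one
    obtain ⟨s'', hs, hs1, hs2⟩ := ih (by linarith)
    have hq := hr.hatDist_le
    obtain ⟨a1, a2, a3⟩ := inside (x := y) (z := y') (t' := 1 + t'') hy
      (by linarith [hatDist_triangle y' y'' q, hatDist_comm y' y'']) (by ring)
    have b1 : visualSize m y' y'' ≤ (2 : ℝ) ^ (t'' - 13) :=
      (visualSize_le (b := 13 - t'') fun S hS w hw => by
        linarith [h.symm.hatDist_le_one_of_mem hS.symm hw, hatDist_triangle m w q,
          hatDist_triangle w y'' q, hatDist_comm w y'']).trans (pow_le (by linarith))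
    have b2 : visualSize m y' y'' ≤ (2 : ℝ) ^ (11 / 10 - t'') :=
      (visualSize_le (b := t'' - 11 / 10) fun S hS w hw => by
        linarith [h.hatDist_le_one_of_mem hS hw, hatDist_triangle m w y',
          hatDist_comm w y']).trans (pow_le (by linarith))
    refine ⟨_, (hs.cons (x := y')).cons (x := y), ?_⟩
    -- Each jump costs 1, so the tail is at most half of the target, and the move and the jump at
    -- most a quarter each.
    have small : dist y y' + 1 + t'' ≤ 8 → visualSize m y y' + (visualSize m y' y'' + s'') ≤
        (2 : ℝ) ^ (dist y y' + 1 + t'' - 12) := by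
      intro h8
      set t := dist y y' + 1 + t'' with ht
      have e1 := rpow_two_succ (t - 13)
      have e2 := rpow_two_succ (t - 14)
      rw [show t - 13 + 1 = t - 12 by ring] at e1
      rw [show t - 14 + 1 = t - 13 by ring] at e2
      have c1 : (2 : ℝ) ^ (t'' - 12) ≤ (2 : ℝ) ^ (t - 13) := pow_le (by linarith)
      have c2 : (2 : ℝ) ^ (t'' - 13) ≤ (2 : ℝ) ^ (t - 14) := pow_le (by linarith)
      linarith [hs1 (by linarith)]
    refine ⟨small, fun h7 => ?_⟩
    rcases le_total (dist y y' + 1 + t'') 8 with h8 | h8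
    · exact second h7 (small h8) h8
    rcases le_total t'' 7 with h7'' | h7''
    · have c1 : (2 : ℝ) ^ (t'' - 12) ≤ (2 : ℝ) ^ (-((5 : ℕ) : ℝ)) :=
        pow_le (by push_cast; linarith)
      have c2 : (2 : ℝ) ^ (t'' - 13) ≤ (2 : ℝ) ^ (-((6 : ℕ) : ℝ)) :=
        pow_le (by push_cast; linarith)
      have c3 : (2 : ℝ) ^ (-(dist y y' + 1 + t'')) ≤ (2 : ℝ) ^ (-((8 : ℕ) : ℝ)) :=
        pow_le (by push_cast; linarith)
      rw [pow_nat] at c1 c2 c3 a2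
      have := hs1 (by linarith)
      norm_num at c1 c2 a2
      linarith
    · have e1 := rpow_two_succ (-t'' - 1)
      rw [sub_add_cancel] at e1
      -- The move and the jump add `6 * 2 ^ (1 / 10)` times `2 ^ (-t'' - 1)`. Rounded up to 7 times,
      -- this is what the correction term gains when it drops from 14 to 7 times that power.
      have tenth : (2 : ℝ) ^ (1 / 10 : ℝ) ≤ 7 / 6 := by
        rw [← Real.rpow_le_rpow_iff (z := 10) (by positivity) (by norm_num) (by norm_num),
          ← Real.rpow_mul two_pos.le]
        norm_num
      have e2 : (2 : ℝ) ^ (11 / 10 - t'') = 4 * ((2 : ℝ) ^ (1 / 10 : ℝ) * 2 ^ (-t'' - 1)) := by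
        rw [← Real.rpow_add two_pos, show (4 : ℝ) = 2 ^ (2 : ℝ) by norm_num,
          ← Real.rpow_add two_pos]
        congr 1; ring
      have e3 : (2 : ℝ) ^ (11 / 10 - (1 + t'')) =
          2 * ((2 : ℝ) ^ (1 / 10 : ℝ) * 2 ^ (-t'' - 1)) := by
        rw [← Real.rpow_add two_pos, ← rpow_two_succ]
        congr 1; ring
      have c1 : (2 : ℝ) ^ (-(dist y y' + 1 + t'')) ≤ 2 ^ (-t'' - 1) := pow_le (by linarith)
      have c2 := mul_le_mul_of_nonneg_right tenth (pow_pos (-t'' - 1)).le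
      rw [e2] at b2
      rw [e3] at a3
      linarith [hs2 h7'']

/-- Closest points on a geodesic for the two metrics are close to each other in the contraction
space. -/
theorem hatDist_lt_of_closest (hX : IsGeodesicSpace X) {Y G : Set X} {x p q : X}
    (hp : ∀ y ∈ Y, dist x p ≤ dist x y) (hq : ∀ y ∈ Y, hatDist x q ≤ hatDist x y)
    (hG : IsGeodesicSegment G p q) (hGY : G ⊆ Y) : hatDist p q < 17 := by
  by_contra! hge
  obtain ⟨u, hu, hu1, hu2⟩ := exists_initial_part hG (by linarith)
  have hns : ¬ IsShort p u := fun h => by linarith [h.hatDist_le_one]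
  obtain ⟨r, hr, S, m, hS, hm, hpm, hmu, hB⟩ := exists_isBottleneck hns
  obtain ⟨A, hA, hA'⟩ := hG.exists_sub hG.left_mem hu
  have hAu : ∀ v ∈ A, hatDist p v ≤ 2 := fun v hv => hu2 v (hA hv)
    (by linarith [hA'.dist_add_dist hv, dist_nonneg (x := v) (y := u)])
  -- `m` is close to the geodesic
  obtain ⟨v, hv, hvm⟩ : ∃ v ∈ A, dist v m ≤ r := by
    obtain ⟨v, hv | hv | hv, hvm⟩ := hB hS Subset.rfl (.singleton u) (.singleton u) hA'.symm
    · exact ⟨v, by rw [mem_singleton_iff.1 hv]; exact hA'.right_mem, hvm⟩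
    · exact ⟨v, by rw [mem_singleton_iff.1 hv]; exact hA'.right_mem, hvm⟩
    · exact ⟨v, hv, hvm⟩
  obtain ⟨v', hv', hvm'⟩ := exists_hatDist_le_one_bigon hS hA' hm
  -- `m` is close to a geodesic from `x` to `q`
  obtain ⟨G', hG', hSG', -⟩ := hG.exists_replace hG.left_mem hu (by simp) hS
  obtain ⟨B, hB'⟩ := hX q x
  obtain ⟨C, hC⟩ := hX x p
  obtain ⟨y, hy, hmin, hym⟩ := exists_closest_triangle hG' hB' hC (hSG' hm)
  have hyr : dist m y ≤ r := by
    obtain ⟨z, hz, hzm⟩ := hB hG' hSG' hB' hC (.singleton p)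
    rw [dist_comm] at hzm
    rcases hz with hz | hz | hz
    · exact (hmin z (.inl hz)).trans hzm
    · exact (hmin z (.inr hz)).trans hzm
    · rw [mem_singleton_iff.1 hz] at hzm
      exact (hmin p (.inr hC.right_mem)).trans hzm
  -- If `y` were on the geodesic from `x` to `p`, the point `v` of `Y`, at distance at most `2 * r`
  -- from `y`, would be closer to `x` than `p`, as `y` is more than `4 * r` from `p`.
  have hyB : y ∈ B := by
    refine hy.resolve_right fun hyC => ?_
    have h1 := hC.dist_add_dist hyC
    have h2 := hp v (hGY (hA hv))
    have h3 := dist_triangle x y v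
    have h4 := dist_triangle y m v
    have h5 := dist_triangle p y m
    rw [dist_comm y m, dist_comm m v] at h4
    rw [dist_comm p y, dist_comm y m] at h5
    linarith
  -- the distances of `m` in the contraction space
  have hmq : 14 ≤ hatDist m q := by
    linarith [hatDist_triangle p m q, hatDist_triangle p v' m, hatDist_comm v' m, hAu v' hv']
  have hmx : hatDist x q - 1 ≤ hatDist m x := by
    linarith [hq v' (hGY (hA hv')), hatDist_triangle x m v', hatDist_comm m x]
  obtain ⟨t, ht, hroute⟩ := exists_route x q (ε := 1 / 10) (by norm_num)
  -- The defect 11/10 is 1 from `hmx` plus the slack 1/10 of the route. The visual size of `(x, q)`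
  -- is at least 1/2, so Frink's inequality requires `s ≥ 1/8`, which is more than 15/128 and 1/16.
  obtain ⟨s, hs, hs1, hs2⟩ := hroute.exists_isPathSum hmq (by linarith)
  have h1 : (2 : ℝ) ^ (-hatDist m y) ≤ visualSize m x q := le_visualSize hB'.symm hyB
  have h2 : (2 : ℝ) ^ (-1 : ℝ) ≤ 2 ^ (-hatDist m y) :=
    Real.rpow_le_rpow_of_exponent_le one_le_two (by linarith)
  have h3 := hs.visualSize_le hX
  rw [Real.rpow_neg_one] at h2
  rcases le_total t 8 with h8 | h8
  · have h4 : (2 : ℝ) ^ (t - 12) ≤ 2 ^ (-(4 : ℝ)) :=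
      Real.rpow_le_rpow_of_exponent_le one_le_two (by linarith)
    have e4 : (2 : ℝ) ^ (-(4 : ℝ)) = 1 / 16 := by
      rw [Real.rpow_neg two_pos.le]; norm_num
    rw [e4] at h4
    linarith [hs1 h8]
  · have h4 : (0 : ℝ) < 2 ^ (-t) := by positivity
    linarith [hs2 (by linarith)]

end Contraction

/-! ### Stability of quasi-geodesics for `hatDist` -/

namespace Contraction

open IsGeodesicSegment

/-- With truncated subtraction the exponent is |i - k|; the sum is bounded by two geometric series.
-/
theorem sum_range_pow_dist_le {ρ : ℝ} (h0 : 0 ≤ ρ) (h1 : ρ < 1) (n k : ℕ) :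
    ∑ i ∈ Finset.range n, ρ ^ ((i - k) + (k - i)) ≤ 2 * (1 - ρ)⁻¹ := by
  have geom : ∀ n, ∑ i ∈ Finset.range n, ρ ^ i ≤ (1 - ρ)⁻¹ := fun n => by
    rw [← tsum_geometric_of_lt_one h0 h1]
    exact (summable_geometric_of_lt_one h0 h1).sum_le_tsum _ fun i _ => pow_nonneg h0 i
  have e1 : ∑ i ∈ Finset.range k, ρ ^ ((i - k) + (k - i)) ≤ (1 - ρ)⁻¹ := by
    refine le_trans ?_ (geom k)
    rw [← Finset.sum_range_reflect]
    refine Finset.sum_le_sum fun i hi => ?_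
    have := Finset.mem_range.1 hi
    exact pow_le_pow_of_le_one h0 h1.le (by omega)
  have e2 : ∑ i ∈ Finset.range n, ρ ^ ((k + i - k) + (k - (k + i))) ≤ (1 - ρ)⁻¹ := by
    refine le_trans (le_of_eq (Finset.sum_congr rfl fun i _ => ?_)) (geom n)
    congr 1; omega
  calc _ ≤ ∑ i ∈ Finset.range (k + n), ρ ^ ((i - k) + (k - i)) :=
        Finset.sum_le_sum_of_subset_of_nonneg (Finset.range_mono (by omega))
          fun i _ _ => pow_nonneg h0 _
    _ ≤ _ := by rw [Finset.sum_range_add]; linarith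

variable {X : Type u} [MetricSpace X]

/-- A Lipschitz path, defined on an interval `I`, which does not return in the contraction
space. -/
structure IsHatPath (c : ℝ → X) (I : Set ℝ) (L C : ℝ) : Prop where
  ordConnected : I.OrdConnected
  nonneg : 0 ≤ L
  one_le : 1 ≤ C
  dist_le : ∀ s ∈ I, ∀ t ∈ I, dist (c s) (c t) ≤ L * |s - t|
  le_hatDist : ∀ s ∈ I, ∀ t ∈ I, |s - t| / C - C ≤ hatDist (c s) (c t)

namespace IsHatPath

variable {c : ℝ → X} {I : Set ℝ} {L C : ℝ}

theorem abs_sub_le (h : IsHatPath c I L C) {s t : ℝ} (hs : s ∈ I) (ht : t ∈ I) :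
    |s - t| ≤ C * (hatDist (c s) (c t) + C) := by
  have hC := h.one_le
  have := h.le_hatDist s hs t ht
  rw [sub_le_iff_le_add, div_le_iff₀ (by linarith)] at this
  linarith

theorem continuousOn (h : IsHatPath c I L C) : ContinuousOn c I := by
  have : LipschitzOnWith ⟨L, h.nonneg⟩ c I := LipschitzOnWith.of_dist_le_mul fun s hs t ht => by
    rw [Real.dist_eq]; exact h.dist_le s hs t ht
  exact this.continuousOn

/-- Geodesics stay close to the path, in the contraction space. -/
theorem exists_forall_hatDist_le (hX : IsGeodesicSpace X) (h : IsHatPath c I L C) :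
    ∃ H, 0 ≤ H ∧ ∀ a ∈ I, ∀ b ∈ I, a ≤ b → ∀ S, IsGeodesicSegment S (c a) (c b) → ∀ u ∈ S,
      ∃ t ∈ Icc a b, hatDist u (c t) ≤ H := by
  have hC := h.one_le
  have hC0 : 0 < C := by linarith
  set ρ : ℝ := (2 : ℝ) ^ (-(1 / (4 * C))) with hρ
  have hρ0 : 0 < ρ := by positivity
  have hρ1 : ρ < 1 := Real.rpow_lt_one_of_one_lt_of_neg one_lt_two (by
    have : 0 < 1 / (4 * C) := by positivity
    linarith)
  have hρn : ∀ n : ℕ, ρ ^ n = (2 : ℝ) ^ (-(n / (4 * C))) := fun n => by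
    rw [hρ, ← Real.rpow_natCast, ← Real.rpow_mul two_pos.le]
    congr 1; ring
  set K := 1 / (4 * C) + C / 4 + L with hK
  set Q := 4 * (2 ^ K * (2 * (1 - ρ)⁻¹)) with hQ
  have h1ρ : 0 < (1 - ρ)⁻¹ := inv_pos.2 (by linarith)
  have hQ0 : 0 < Q := by positivity
  refine ⟨max 0 (2 * Real.logb 2 Q), le_max_left _ _, ?_⟩
  intro a ha b hb hab S hS u hu
  have hIcc : Icc a b ⊆ I := h.ordConnected.out ha hb
  rcases hab.eq_or_lt with rfl | hlt
  · refine ⟨a, ⟨le_rfl, le_rfl⟩, ?_⟩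
    have := hS.dist_add_dist hu
    rw [dist_self] at this
    have h2 : dist (c a) u = 0 := le_antisymm (by linarith [dist_nonneg (x := u) (y := c a)])
      dist_nonneg
    rw [← dist_eq_zero.1 h2, hatDist_self]
    exact le_max_left _ _
  obtain ⟨t₀, ht₀, hmin⟩ := isCompact_Icc.exists_isMinOn (f := fun t => hatDist u (c t))
    ⟨a, le_rfl, hab⟩ ((continuous_hatDist u).comp_continuousOn (h.continuousOn.mono hIcc))
  have hmin' : ∀ t ∈ Icc a b, hatDist u (c t₀) ≤ hatDist u (c t) := fun t ht => hmin ht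
  refine ⟨t₀, ht₀, ?_⟩
  set D := hatDist u (c t₀) with hD
  obtain ⟨n, hn⟩ : ∃ n, ⌈b - a⌉₊ = n + 1 :=
    Nat.exists_eq_succ_of_ne_zero (Nat.pos_iff_ne_zero.1 (Nat.ceil_pos.2 (by linarith)))
  have hn1 : b - a ≤ n + 1 := by
    have := Nat.le_ceil (b - a)
    rw [hn] at this; exact_mod_cast this
  have hn2 : ∀ i ≤ n, a + i < b := fun i hi => by
    have : i < ⌈b - a⌉₊ := by omega
    rw [Nat.lt_ceil] at this
    linarith
  -- Sample the path at unit steps, stopped at `b`; `k` below is the index near the closest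
  -- parameter `t₀`.
  set w : ℕ → X := fun i => c (min (a + i) b) with hw
  have hw0 : w 0 = c a := by simp [hw, hab]
  have hwn : w (n + 1) = c b := by
    simp only [hw]; rw [min_eq_right]; push_cast; linarith
  have hmem : ∀ i : ℕ, min (a + i) b ∈ Icc a b := fun i =>
    ⟨le_min (by linarith [(Nat.cast_nonneg i : (0 : ℝ) ≤ i)]) hab, min_le_right _ _⟩
  set k := ⌊t₀ - a⌋₊ with hk
  have hk1 : (k : ℝ) ≤ t₀ - a := Nat.floor_le (by linarith [ht₀.1])
  have hk2 : t₀ - a < k + 1 := Nat.lt_floor_add_one _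
  have hterm : ∀ i ∈ Finset.range (n + 1), visualSize u (w i) (w (i + 1)) ≤
      2 ^ K * 2 ^ (-(D / 2)) * ρ ^ ((i - k) + (k - i)) := by
    intro i hi
    have hi' := hn2 i (by have := Finset.mem_range.1 hi; omega)
    have e : w i = c (a + i) := by simp only [hw]; rw [min_eq_left hi'.le]
    have hmi : a + i ∈ Icc a b := ⟨by linarith [(Nat.cast_nonneg i : (0 : ℝ) ≤ i)], hi'.le⟩
    have hstep : dist (w i) (w (i + 1)) ≤ L := by
      have := h.dist_le _ (hIcc (hmem i)) _ (hIcc (hmem (i + 1)))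
      refine this.trans (mul_le_of_le_one_right h.nonneg ?_)
      rw [min_eq_left hi'.le, abs_sub_comm, abs_of_nonneg]
      · have := min_le_left (a + ((i + 1 : ℕ) : ℝ)) b
        push_cast at this ⊢; linarith
      · rw [sub_nonneg]
        refine le_min ?_ hi'.le
        push_cast; linarith
    have hd1 := hmin' _ hmi
    have hd2 := h.le_hatDist _ (hIcc hmi) _ (hIcc ht₀)
    have hd3 := hatDist_triangle (c (a + i)) u (c t₀)
    rw [hatDist_comm _ u] at hd3
    have hik : (((i - k) + (k - i) : ℕ) : ℝ) - 1 ≤ |a + i - t₀| := by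
      rcases le_total i k with hik | hik
      · rw [Nat.sub_eq_zero_of_le hik, zero_add, Nat.cast_sub hik]
        have := neg_abs_le (a + i - t₀)
        linarith
      · rw [Nat.sub_eq_zero_of_le hik, add_zero, Nat.cast_sub hik]
        have := le_abs_self (a + i - t₀)
        linarith
    set N := (i - k) + (k - i)
    have hdiv : ((N : ℝ) - 1) / C ≤ |a + i - t₀| / C := by gcongr
    rw [hρn, ← Real.rpow_add two_pos, ← Real.rpow_add two_pos]
    -- The sample point is at `hatDist` at least `D` from `u` and, up to constants, at least `N / C
    -- - D`. Weights 3/4 and 1/4 give `D / 2 + N / (4 * C)`, which both decays in `D` and is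
    -- summable over `N`.
    refine (visualSize_le (b := D / 2 + N / (4 * C) - K) fun S' hS' v hv => ?_).trans
      (Real.rpow_le_rpow_of_exponent_le one_le_two (by linarith))
    have hd4 := hatDist_triangle u v (w i)
    have hd5 := hatDist_le_dist v (w i)
    have hd6 := hS'.dist_add_dist hv
    rw [dist_comm v] at hd5
    have hd7 := dist_nonneg (x := v) (y := w (i + 1))
    rw [← e] at hd1 hd2 hd3
    have e1 : (N : ℝ) / (4 * C) = (N / C) / 4 := by field_simp
    have e2 : 1 / (4 * C) = (1 / C) / 4 := by field_simp
    rw [sub_div] at hdiv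
    rw [hK, e1, e2]
    linarith
  have hfr := frink (visualSize_nonneg u) (visualSize_triangle hX u) w n
  have hsum := Finset.sum_le_sum hterm
  rw [← Finset.mul_sum] at hsum
  have hgeo := mul_le_mul_of_nonneg_left (sum_range_pow_dist_le hρ0.le hρ1 (n + 1) k)
    (show 0 ≤ (2 : ℝ) ^ K * 2 ^ (-(D / 2)) by positivity)
  -- The point `u` itself lies on a geodesic between the ends.
  have hone : 1 ≤ visualSize u (w 0) (w (n + 1)) := by
    rw [hw0, hwn]
    simpa [hatDist_self] using le_visualSize (m := u) hS hu
  have hfin : 1 ≤ Q * (2 : ℝ) ^ (-(D / 2)) := by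
    calc (1 : ℝ) ≤ _ := hone
      _ ≤ _ := hfr
      _ ≤ 4 * (2 ^ K * 2 ^ (-(D / 2)) * (2 * (1 - ρ)⁻¹)) := by linarith
      _ = _ := by rw [hQ]; ring
  have hpow : (2 : ℝ) ^ (D / 2) ≤ Q := by
    rw [Real.rpow_neg two_pos.le, ← div_eq_mul_inv, one_le_div (by positivity)] at hfin
    exact hfin
  have hlog : D / 2 ≤ Real.logb 2 Q := (Real.le_logb_iff_rpow_le one_lt_two hQ0).2 hpow
  exact le_trans (by linarith) (le_max_right _ _)

end IsHatPath

/-- A closest point `y` to `m` on a side of a geodesic triangle with vertex `m` is close, in the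
contraction space, to the side from `m` to their common vertex. -/
theorem exists_hatDist_le_four {m q w y : X} {A V : Set X} (hX : IsGeodesicSpace X)
    (hA : IsGeodesicSegment A m q) (hV : IsGeodesicSegment V q w) (hy : y ∈ V)
    (hmin : ∀ y' ∈ V, dist m y ≤ dist m y') :
    ∃ e ∈ A, dist m e ≤ dist m y ∧ hatDist e y ≤ 4 := by
  rcases lt_or_ge (hatDist y m) (3 / 2) with hlt | hge
  · exact ⟨m, hA.left_mem, by simp, by rw [hatDist_comm]; linarith⟩
  obtain ⟨S, hS⟩ := hX y m
  obtain ⟨u, hu, hu1, hu2⟩ := exists_initial_part hS hge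
  have hns : ¬ IsShort y u := fun h => by linarith [h.hatDist_le_one]
  obtain ⟨r, hr, T, z, hT, hz, hyz, hzu, hB⟩ := exists_isBottleneck hns
  obtain ⟨U, hU, hU'⟩ := hS.exists_sub hS.left_mem hu
  obtain ⟨v, hv, hzv⟩ := exists_hatDist_le_one_bigon hT hU' hz
  have hv2 := hu2 v (hU hv) (by linarith [hU'.dist_add_dist hv, dist_nonneg (x := v) (y := u)])
  obtain ⟨Z, hZ, hTZ, -⟩ := hS.exists_replace hS.left_mem hu (by simp) hT
  obtain ⟨B, hB1, hB2⟩ := hV.exists_sub hV.left_mem hy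
  obtain ⟨e, he, hmin', hze⟩ := exists_closest_triangle hZ hA hB2 (hTZ hz)
  have her : dist z e ≤ r := by
    obtain ⟨p, hp, hpz⟩ := hB hZ hTZ hA hB2 (.singleton y)
    rw [dist_comm] at hpz
    rcases hp with hp | hp | hp
    · exact (hmin' p (.inl hp)).trans hpz
    · exact (hmin' p (.inr hp)).trans hpz
    · rw [mem_singleton_iff.1 hp] at hpz
      exact (hmin' y (.inr hB2.right_mem)).trans hpz
  have hadd := hZ.dist_add_dist (hTZ hz)
  have htri := dist_triangle m z e
  rw [dist_comm m z] at htri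
  rw [dist_comm y m] at hadd
  have heA : e ∈ A := he.resolve_right fun heB => by
    linarith [hmin e (hB1 heB)]
  refine ⟨e, heA, by linarith, ?_⟩
  -- 4 = 1 (`e` to `z`) + 1 (`z` to `v`) + 2 (`v` to `y`).
  linarith [hatDist_triangle e z y, hatDist_triangle z v y, hatDist_comm e z, hatDist_comm v y]

end Contraction

/-! ### Bottlenecks along a path, and strong contraction -/

namespace Contraction

open IsGeodesicSegment

variable {X : Type u} [MetricSpace X]

namespace IsHatPath

variable {c : ℝ → X} {I : Set ℝ} {L C H : ℝ}

theorem abs_sub_le_of_close (h : IsHatPath c I L C) {s t : ℝ} (hs : s ∈ I) (ht : t ∈ I) {x y : X}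
    {α β : ℝ} (hx : hatDist x (c s) ≤ α) (hy : hatDist y (c t) ≤ β) :
    |s - t| ≤ C * (hatDist x y + α + β + C) := by
  refine (h.abs_sub_le hs ht).trans (mul_le_mul_of_nonneg_left ?_ (by linarith [h.one_le]))
  linarith [hatDist_triangle (c s) x (c t), hatDist_triangle x y (c t), hatDist_comm (c s) x]

/-- If `j w` is the parameter of a point of the path close to the point `w` of a geodesic, then
some subsegment of the geodesic travels from `i₁` to `i₂` without moving far away from this
interval. -/
theorem exists_window (h : IsHatPath c I L C) (hH : 0 ≤ H) {a b i₁ i₂ K : ℝ} (ha : a ∈ I)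
    (hb : b ∈ I) (hab : a ≤ b) (hK : K = C * (2 * H + C + 1))
    (h1 : a + 2 * K ≤ i₁) (h12 : i₁ + K < i₂) (h2 : i₂ + 2 * K ≤ b)
    {S : Set X} (hS : IsGeodesicSegment S (c a) (c b)) {j : X → ℝ}
    (hj : ∀ w ∈ S, j w ∈ Icc a b ∧ hatDist w (c (j w)) ≤ H) :
    ∃ u ∈ S, ∃ v ∈ S, dist (c a) u ≤ dist (c a) v ∧ j u ≤ i₁ ∧ i₂ ≤ j v ∧
      (∀ w ∈ S, dist (c a) u ≤ dist (c a) w → i₁ - 2 * K ≤ j w) ∧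
      (∀ w ∈ S, dist (c a) u ≤ dist (c a) w → dist (c a) w ≤ dist (c a) v →
        j w ≤ i₂ + 2 * K) := by
  have hC := h.one_le
  have hK0 : 0 ≤ K := by rw [hK]; positivity
  have hIcc : Icc a b ⊆ I := h.ordConnected.out ha hb
  -- The choice `j` need not be continuous; `K` bounds its variation over unit distance, a coarse
  -- substitute for the intermediate value theorem.
  have jump : ∀ w ∈ S, ∀ w' ∈ S, |dist (c a) w - dist (c a) w'| ≤ 1 → |j w - j w'| ≤ K := by
    intro w hw w' hw' hd
    rw [← hS.dist_eq_abs hw hw'] at hd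
    rw [hK]
    refine (h.abs_sub_le_of_close (hIcc (hj w hw).1) (hIcc (hj w' hw').1) (hj w hw).2
      (hj w' hw').2).trans (mul_le_mul_of_nonneg_left ?_ (by linarith))
    linarith [hatDist_le_dist w w']
  have ends : ∀ t ∈ Icc a b, c t ∈ S → |j (c t) - t| ≤ K := by
    intro t ht hct
    rw [hK]
    refine (h.abs_sub_le_of_close (hIcc (hj _ hct).1) (hIcc ht) (hj _ hct).2
      (hatDist_self (c t)).le).trans (mul_le_mul_of_nonneg_left ?_ (by linarith))
    rw [hatDist_self]; linarith
  have ja := abs_le.1 (ends a ⟨le_rfl, hab⟩ hS.left_mem)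
  have jb := abs_le.1 (ends b ⟨hab, le_rfl⟩ hS.right_mem)
  have hle : ∀ w ∈ S, dist (c a) w ≤ dist (c a) (c b) := fun w hw => by
    linarith [hS.dist_add_dist hw, dist_nonneg (x := w) (y := c b)]
  -- the last point with parameter at most `i₁`, up to an error
  set T : Set ℝ := {d | ∃ w ∈ S, j w ≤ i₁ ∧ dist (c a) w = d} with hT
  have hTne : T.Nonempty := ⟨_, c a, hS.left_mem, by linarith, rfl⟩
  have hTb : BddAbove T := ⟨dist (c a) (c b), by rintro _ ⟨w, hw, -, rfl⟩; exact hle w hw⟩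
  obtain ⟨_, ⟨u, hu, hju, rfl⟩, hus⟩ := exists_lt_of_lt_csSup hTne (sub_one_lt (sSup T))
  have hgt : ∀ w ∈ S, sSup T < dist (c a) w → i₁ < j w := fun w hw hlt => by
    by_contra! hle
    exact absurd (le_csSup hTb ⟨w, hw, hle, rfl⟩) (not_le.2 hlt)
  have hjuK : i₁ - K ≤ j u := by
    rcases le_total (dist (c a) u + 1) (dist (c a) (c b)) with hle' | hle'
    · obtain ⟨w, hw, hd⟩ := hS.exists_dist_eq (t := dist (c a) u + 1) (by positivity) hle'
      have e1 := hgt w hw (by linarith)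
      have e2 := abs_le.1 (jump u hu w hw (by rw [hd]; simp))
      linarith
    · have e2 := abs_le.1 (jump u hu (c b) hS.right_mem (by
        rw [abs_sub_comm, abs_of_nonneg (by linarith [hle u hu])]; linarith))
      linarith
  have hafter : ∀ w ∈ S, dist (c a) u ≤ dist (c a) w → i₁ - 2 * K ≤ j w := by
    intro w hw huw
    rcases lt_or_ge (sSup T) (dist (c a) w) with hlt | hge
    · linarith [hgt w hw hlt]
    · have := abs_le.1 (jump u hu w hw (by
        rw [abs_sub_comm, abs_of_nonneg (by linarith)]; linarith))
      linarith
  -- the first later point with parameter at least `i₂`, up to an error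
  set T' : Set ℝ := {d | ∃ w ∈ S, dist (c a) u ≤ dist (c a) w ∧ i₂ ≤ j w ∧ dist (c a) w = d}
    with hT'
  have hTne' : T'.Nonempty := ⟨_, c b, hS.right_mem, hle u hu, by linarith, rfl⟩
  have hTb' : BddBelow T' := ⟨0, by rintro _ ⟨w, -, -, -, rfl⟩; exact dist_nonneg⟩
  obtain ⟨_, ⟨v, hv, huv, hjv, rfl⟩, hvs⟩ := exists_lt_of_csInf_lt hTne' (lt_add_one (sInf T'))
  have hlt : ∀ w ∈ S, dist (c a) u ≤ dist (c a) w → dist (c a) w < sInf T' → j w < i₂ :=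
    fun w hw huw hlt => by
      by_contra! hle
      exact absurd (csInf_le hTb' ⟨w, hw, huw, hle, rfl⟩) (not_le.2 hlt)
  have hjvK : j v ≤ i₂ + K := by
    rcases le_total (dist (c a) u) (dist (c a) v - 1) with hle' | hle'
    · obtain ⟨w, hw, hd⟩ := hS.exists_dist_eq (t := dist (c a) v - 1)
        (by linarith [dist_nonneg (x := c a) (y := u)]) (by linarith [hle v hv])
      have e1 := hlt w hw (by linarith) (by linarith)
      have e2 := abs_le.1 (jump v hv w hw (by rw [hd]; simp))
      linarith
    · have e2 := abs_le.1 (jump v hv u hu (by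
        rw [abs_of_nonneg (by linarith)]; linarith))
      linarith
  refine ⟨u, hu, v, hv, huv, hju, hjv, hafter, fun w hw huw hwv => ?_⟩
  rcases lt_or_ge (dist (c a) w) (sInf T') with hlt' | hge
  · linarith [hlt w hw huw hlt']
  · have := abs_le.1 (jump v hv w hw (by rw [abs_of_nonneg (by linarith)]; linarith))
    linarith

/-- A subsegment of a geodesic between points of the path, travelling from `i` to `i + W`, can be
replaced by a geodesic having a bottleneck, whose distance from the path is controlled. -/
theorem exists_bottleneck_window (hX : IsGeodesicSpace X) (h : IsHatPath c I L C) (hH : 0 ≤ H)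
    (hclose : ∀ a ∈ I, ∀ b ∈ I, a ≤ b → ∀ S, IsGeodesicSegment S (c a) (c b) → ∀ u ∈ S,
      ∃ t ∈ Icc a b, hatDist u (c t) ≤ H)
    {a b i K W P : ℝ} (ha : a ∈ I) (hb : b ∈ I) (hab : a ≤ b) (hK : K = C * (2 * H + C + 1))
    (hW : W = C * (2 * H + C + 2)) (hP : P = 2 * K + C * (2 * H + C + 6)) (h1 : a + P ≤ i)
    (h2 : i + W + P ≤ b) {S : Set X} (hS : IsGeodesicSegment S (c a) (c b)) {j : X → ℝ}
    (hj : ∀ w ∈ S, j w ∈ Icc a b ∧ hatDist w (c (j w)) ≤ H) :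
    ∃ u ∈ S, ∃ v ∈ S, dist (c a) u ≤ dist (c a) v ∧
      (∀ w ∈ S, dist (c a) u ≤ dist (c a) w → i - 2 * K ≤ j w) ∧ j v ≤ i + W + 2 * K ∧
      ∃ r, 0 ≤ r ∧ ∃ S' m, IsGeodesicSegment S' u v ∧ m ∈ S' ∧ 5 * r + 1 / 2 ≤ dist u m ∧
        5 * r + 1 / 2 ≤ dist m v ∧ IsBottleneck r S' m ∧
        dist m (c (i - P)) ≤ r + L * (W + 2 * P) := by
  have hC := h.one_le
  have hC0 : 0 < C := by linarith
  have hL := h.nonneg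
  have hK0 : 0 ≤ K := by rw [hK]; positivity
  have hPK : 2 * K + C * (2 * H + C + 5) < P := by rw [hP]; nlinarith
  have hP0 : 2 * K ≤ P := by rw [hP]; linarith [show 0 ≤ C * (2 * H + C + 6) by positivity]
  have hKW : K < W := by rw [hK, hW]; nlinarith
  have hIcc : Icc a b ⊆ I := h.ordConnected.out ha hb
  obtain ⟨u, hu, v, hv, huv, hju, hjv, hafter, hbetween⟩ :=
    h.exists_window hH ha hb hab hK (by linarith) (show i + K < i + W by linarith) (by linarith)
      hS hj
  refine ⟨u, hu, v, hv, huv, hafter, hbetween v hv huv le_rfl, ?_⟩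
  have hns : ¬ IsShort u v := fun hs => by
    have e := h.abs_sub_le_of_close (hIcc (hj v hv).1) (hIcc (hj u hu).1) (hj v hv).2 (hj u hu).2
    have e1 := le_abs_self (j v - j u)
    have e2 : C * (hatDist v u + H + H + C) ≤ C * (2 * H + C + 1) :=
      mul_le_mul_of_nonneg_left (by linarith [hs.symm.hatDist_le_one]) hC0.le
    linarith
  obtain ⟨r, hr, S', m, hS', hm, hum, hmv, hB⟩ := exists_isBottleneck hns
  refine ⟨r, hr, S', m, hS', hm, hum, hmv, hB, ?_⟩
  obtain ⟨A, hA, hA'⟩ := hS.exists_sub hu hv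
  have hSA : ∀ e ∈ S', ∃ t ∈ Icc (i - 2 * K) (i + W + 2 * K), t ∈ I ∧
      hatDist e (c t) ≤ H + 1 := by
    intro e he
    obtain ⟨w, hw, hew⟩ := exists_hatDist_le_one_bigon hS' hA' he
    have hw' := hS.dist_mem_Icc hA hA' huv hw
    refine ⟨j w, ⟨hafter w (hA hw) hw'.1, hbetween w (hA hw) hw'.1 hw'.2⟩,
      hIcc (hj w (hA hw)).1, ?_⟩
    linarith [hatDist_triangle e w (c (j w)), (hj w (hA hw)).2]
  obtain ⟨G, hG, hSG, hGS⟩ := hS.exists_replace hu hv huv hS'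
  have hmG := hG.dist_mem_Icc hSG hS' huv hm
  -- The margin `5 * r + 1 / 2` keeps the `r`-ball around `m` away from the rest of `G`.
  have hin : ∀ e ∈ G, dist m e ≤ r → e ∈ S' := by
    intro e he hme
    rcases hGS e he with he' | ⟨-, he' | he'⟩
    · exact he'
    · have e1 := hG.dist_eq_sub he (hSG hm) (by linarith [hmG.1])
      have e2 := hG.dist_eq_sub (hSG hS'.left_mem) (hSG hm) hmG.1
      rw [dist_comm] at hme
      linarith
    · have e1 := hG.dist_eq_sub (hSG hm) he (by linarith [hmG.2])
      have e2 := hG.dist_eq_sub (hSG hm) (hSG hS'.right_mem) hmG.2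
      linarith
  -- the sides of the quadrangle
  have hT₁ : i - P ∈ Icc a b := ⟨by linarith, by linarith⟩
  have hT₂ : i + W + P ∈ Icc a b := ⟨by linarith, by linarith⟩
  -- If `V` met the `r`-ball around `m`, `exists_hatDist_le_four` would give a point of `S'` at
  -- `hatDist` at most 4 from `V`, but their parameters are too far apart by the choice of `P`.
  have far : ∀ {q t V A'} (_ : t ∈ Icc a b) (_ : IsGeodesicSegment A' m q) (_ : A' ⊆ G)
      (_ : IsGeodesicSegment V q (c t))
      (_ : ∀ y ∈ V, ∃ s ∈ I, hatDist y (c s) ≤ H ∧ (s ≤ i - P ∨ i + W + P ≤ s)),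
      ∀ z ∈ V, ¬ dist z m ≤ r := by
    intro q t V A' _ hA' hAG hV hVs z hz hzm
    obtain ⟨y, hy, hmin⟩ := hV.exists_closest m
    obtain ⟨e, he, hme, hey⟩ := exists_hatDist_le_four hX hA' hV hy hmin
    have hyz := hmin z hz
    rw [dist_comm] at hzm
    obtain ⟨t₁, ht₁, htI, het⟩ := hSA e (hin e (hAG he) (by linarith))
    obtain ⟨s, hsI, hys, hs⟩ := hVs y hy
    have e1 := h.abs_sub_le_of_close htI hsI het hys
    have e2 : C * (hatDist e y + (H + 1) + H + C) ≤ C * (2 * H + C + 5) :=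
      mul_le_mul_of_nonneg_left (by linarith) hC0.le
    have e3 := abs_le.1 (e1.trans e2)
    rcases hs with hs | hs
    · linarith [ht₁.1]
    · linarith [ht₁.2]
  obtain ⟨V₁, hV₁⟩ := hX (c b) (c (i + W + P))
  obtain ⟨V₂, hV₂⟩ := hX (c (i + W + P)) (c (i - P))
  obtain ⟨V₃, hV₃⟩ := hX (c (i - P)) (c a)
  -- The outer sides are excluded by `far`. The middle one joins two points of the path at bounded
  -- parameter distance, so `m` is within `r` plus a constant of the path.
  obtain ⟨z, hz, hzm⟩ := hB hG hSG hV₁ hV₂ hV₃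
  have hz2 : z ∈ V₂ := by
    rcases hz with hz | hz | hz
    · obtain ⟨A', hAG, hA'⟩ := hG.exists_sub (hSG hm) hG.right_mem
      refine absurd hzm (far hT₂ hA' hAG hV₁ (fun y hy => ?_) z hz)
      obtain ⟨s, hs, hys⟩ := hclose _ (hIcc hT₂) b hb hT₂.2 V₁ hV₁.symm y hy
      exact ⟨s, hIcc ⟨hT₂.1.trans hs.1, hs.2⟩, hys, .inr hs.1⟩
    · exact hz
    · obtain ⟨A', hAG, hA'⟩ := hG.exists_sub (hSG hm) hG.left_mem
      refine absurd hzm (far hT₁ hA' hAG hV₃.symm (fun y hy => ?_) z hz)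
      obtain ⟨s, hs, hys⟩ := hclose a ha _ (hIcc hT₁) hT₁.1 V₃ hV₃.symm y hy
      exact ⟨s, hIcc ⟨hs.1, hs.2.trans hT₁.2⟩, hys, .inl hs.2⟩
  have e1 := hV₂.dist_add_dist hz2
  have e2 := h.dist_le _ (hIcc hT₂) _ (hIcc hT₁)
  have e3 : i + W + P - (i - P) = W + 2 * P := by ring
  rw [e3, abs_of_nonneg (by linarith)] at e2
  have e4 := dist_triangle m z (c (i - P))
  rw [dist_comm m z] at e4
  linarith [dist_nonneg (x := c (i + W + P)) (y := z)]

theorem _root_.Contraction.IsBottleneck.mono {r r' : ℝ} {S S' : Set X} {m : X}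
    (h : IsBottleneck r S m) (hr : r ≤ r') (hS : S ⊆ S') : IsBottleneck r' S' m :=
  fun _ _ _ _ _ _ _ _ hG hSG h₁ h₂ h₃ => by
    obtain ⟨z, hz, hzm⟩ := h hG (hS.trans hSG) h₁ h₂ h₃
    exact ⟨z, hz, hzm.trans hr⟩

/-- Some geodesic between two points of the path has a bottleneck of bounded size, at bounded
distance from a given point of the path which is not too close to the ends. -/
theorem exists_forall_isBottleneck (hX : IsGeodesicSpace X) (h : IsHatPath c I L C) :
    ∃ R, 0 ≤ R ∧ ∀ a ∈ I, ∀ b ∈ I, ∀ i, a + R ≤ i → i + R ≤ b →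
      ∃ G m, IsGeodesicSegment G (c a) (c b) ∧ IsBottleneck R G m ∧ dist m (c i) ≤ R := by
  obtain ⟨H, hH, hclose⟩ := h.exists_forall_hatDist_le hX
  have hC := h.one_le
  have hC0 : 0 < C := by linarith
  have hL := h.nonneg
  set K := C * (2 * H + C + 1) with hK
  set W := C * (2 * H + C + 2) with hW
  set P := 2 * K + C * (2 * H + C + 6) with hP
  have hK0 : 0 ≤ K := by positivity
  have hW0 : 0 ≤ W := by positivity
  have hP0 : 0 ≤ P := by positivity
  set B := L * (W + 2 * P) with hB
  have hB0 : 0 ≤ B := by positivity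
  set Q := 2 * B + L * (W + 4 * K + 1) with hQ
  have hQ0 : 0 ≤ Q := by positivity
  have hLP : 0 ≤ L * P := by positivity
  refine ⟨Q + B + L * P + (2 * W + 4 * K + 1 + P), by positivity, ?_⟩
  intro a ha b hb i h1 h2
  have hIcc : Icc a b ⊆ I := h.ordConnected.out ha hb
  have hab : a ≤ b := by linarith
  obtain ⟨S, hS⟩ := hX (c a) (c b)
  choose! j hj using hclose a ha b hb hab S hS
  obtain ⟨u, hu, v, hv, huv, -, hjv, r, hr, S', m, hS', hm, hum, hmv, hBn, hmc⟩ :=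
    h.exists_bottleneck_window hX hH hclose (i := i) ha hb hab hK hW hP (by linarith)
      (by linarith) hS hj
  obtain ⟨u', hu', v', hv', huv', hafter, -, r', hr', S'', m', hS'', hm', hum', hmv', -, hmc'⟩ :=
    h.exists_bottleneck_window hX hH hclose (i := i + (W + 4 * K + 1)) ha hb hab hK hW hP
      (by linarith) (by linarith) hS hj
  have hvu : dist (c a) v ≤ dist (c a) u' := by
    by_contra! hlt
    linarith [hafter v hv hlt.le]
  -- The margins put `m` and `m'` at distance at least `5 * r + 5 * r' + 1`, while passing through
  -- the path bounds it by `r + r' + Q`.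
  have hr_le : r ≤ Q := by
    have e1 := hS.dist_eq_sub hu hv huv
    have e2 := hS.dist_eq_sub hv hu' hvu
    have e3 := hS.dist_eq_sub hu' hv' huv'
    have e4 := hS.dist_add_dist hv'
    have e5 := hS'.dist_add_dist hm
    have e6 := hS''.dist_add_dist hm'
    have t1 := dist_triangle4 (c a) u m m'
    have t2 := dist_triangle4 (c a) m' v' (c b)
    have t3 := dist_triangle4 m (c (i - P)) (c (i + (W + 4 * K + 1) - P)) m'
    have t4 := h.dist_le (i - P) (hIcc ⟨by linarith, by linarith⟩) (i + (W + 4 * K + 1) - P)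
      (hIcc ⟨by linarith, by linarith⟩)
    have e7 : i - P - (i + (W + 4 * K + 1) - P) = -(W + 4 * K + 1) := by ring
    rw [e7, abs_neg, abs_of_nonneg (by linarith)] at t4
    rw [dist_comm (c (i + (W + 4 * K + 1) - P)) m'] at t3
    linarith
  obtain ⟨G, hG, hSG, -⟩ := hS.exists_replace hu hv huv hS'
  refine ⟨G, m, hG, hBn.mono (by linarith) hSG, ?_⟩
  have t1 := dist_triangle m (c (i - P)) (c i)
  have t2 := h.dist_le (i - P) (hIcc ⟨by linarith, by linarith⟩) i (hIcc ⟨by linarith, by linarith⟩)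
  have e7 : i - P - i = -P := by ring
  rw [e7, abs_neg, abs_of_nonneg hP0] at t2
  linarith

/-- A Lipschitz path which is a quasi-geodesic in the contraction space is strongly
contracting. -/
theorem isStronglyContracting (hX : IsGeodesicSpace X) (h : IsHatPath c I L C) :
    IsStronglyContracting (c '' I) := by
  obtain ⟨R, hR, hbot⟩ := h.exists_forall_isBottleneck hX
  have hC := h.one_le
  have hL := h.nonneg
  set M := R + C * (10 * R + 2 + C) with hM
  have hM0 : 0 ≤ M := by positivity
  have hRM : R ≤ M := le_add_of_nonneg_right (by positivity)
  have hfar : ∀ s ∈ I, ∀ t ∈ I, M ≤ |s - t| → 10 * R + 2 ≤ dist (c s) (c t) := by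
    intro s hs t ht hst
    have h1 := h.abs_sub_le hs ht
    have h2 : C * (10 * R + 2 + C) ≤ C * (hatDist (c s) (c t) + C) := by linarith
    have h3 := le_of_mul_le_mul_left h2 (by linarith)
    linarith [hatDist_le_dist (c s) (c t)]
  -- A closest point to `x` may not exist, so `c s` is closest up to 1. Otherwise the quadrangle `c
  -- s`, `x`, `y`, `c t` passes within `2 * R` of `c i`, midway. On `[c s, x]` or `[y, c t]`, `c i`
  -- would be a much closer point. On `[x, y]`, `y` would be within `4 * R` of `c i`, hence `c t`
  -- within `8 * R` of it.
  have hnear : ∀ x s t, s ∈ I → t ∈ I → dist x (c s) ≤ infDist x (c '' I) + 1 →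
      ∀ y, dist x y < infDist x (c '' I) → c t ∈ closestPoints (c '' I) y → |s - t| ≤ 2 * M := by
    intro x s t hs ht hxs y hxy hyt
    by_contra! hlt
    obtain ⟨A, hA⟩ := hX (c s) x
    obtain ⟨B, hB⟩ := hX x y
    obtain ⟨D, hD⟩ := hX y (c t)
    set i := (s + t) / 2 with hi
    obtain ⟨hiI, m, z, hz, hzm, hmi⟩ : i ∈ I ∧ ∃ m z, (z ∈ A ∨ z ∈ B ∨ z ∈ D) ∧ dist z m ≤ R ∧
        dist m (c i) ≤ R := by
      rcases le_total s t with hst | hst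
      · rw [abs_sub_comm, abs_of_nonneg (by linarith)] at hlt
        obtain ⟨G, m, hG, hGm, hmi⟩ := hbot s hs t ht i (by linarith) (by linarith)
        obtain ⟨z, hz, hzm⟩ := hGm hG Subset.rfl hD.symm hB.symm hA.symm
        exact ⟨h.ordConnected.out hs ht ⟨by linarith, by linarith⟩, m, z, by tauto, hzm, hmi⟩
      · rw [abs_of_nonneg (by linarith)] at hlt
        obtain ⟨G, m, hG, hGm, hmi⟩ := hbot t ht s hs i (by linarith) (by linarith)
        obtain ⟨z, hz, hzm⟩ := hGm hG Subset.rfl hA hB hD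
        exact ⟨h.ordConnected.out ht hs ⟨by linarith, by linarith⟩, m, z, by tauto, hzm, hmi⟩
    have hsi := hfar s hs i hiI (by
      rw [hi, show s - (s + t) / 2 = (s - t) / 2 by ring, abs_div, abs_two]; linarith)
    have hti := hfar t ht i hiI (by
      rw [hi, show t - (s + t) / 2 = -((s - t) / 2) by ring, abs_neg, abs_div, abs_two]; linarith)
    have hiY : c i ∈ c '' I := mem_image_of_mem c hiI
    have hzi : dist z (c i) ≤ 2 * R := by linarith [dist_triangle z m (c i)]
    have hxi := infDist_le_dist_of_mem (x := x) hiY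
    have hyi := hyt.2 _ hiY
    have t1 := dist_triangle x z (c i)
    have t2 := dist_triangle y z (c i)
    rcases hz with hz | hz | hz
    · have e1 := hA.dist_add_dist hz
      rw [dist_comm (c s) x, dist_comm z x] at e1
      linarith [dist_triangle (c s) z (c i)]
    · have e1 := hB.dist_add_dist hz
      have t3 := dist_triangle4 (c t) y z (c i)
      rw [dist_comm (c t) y] at t3
      rw [dist_comm y z] at t2 t3
      linarith
    · have e1 := hD.dist_add_dist hz
      have t3 := dist_triangle (c t) z (c i)
      rw [dist_comm (c t) z] at t3
      linarith
  refine ⟨2 * (L * (2 * M)), by positivity, fun x => ediam_le fun p hp q hq => ?_⟩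
  simp only [mem_iUnion] at hp hq
  obtain ⟨y, hy, hp⟩ := hp
  obtain ⟨y', hy', hq⟩ := hq
  rw [mem_ball'] at hy hy'
  have hne : (c '' I).Nonempty := ⟨p, hp.1⟩
  obtain ⟨_, ⟨s, hs, rfl⟩, hxs⟩ := (infDist_lt_iff hne).1 (lt_add_one (infDist x (c '' I)))
  have hbound : ∀ y p, dist x y < infDist x (c '' I) → p ∈ closestPoints (c '' I) y →
      dist (c s) p ≤ L * (2 * M) := by
    rintro y p hy hp
    obtain ⟨t, ht, rfl⟩ := hp.1
    exact (h.dist_le s hs t ht).trans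
      (mul_le_mul_of_nonneg_left (hnear x s t hs ht hxs.le y hy hp) hL)
  rw [edist_dist]
  refine ENNReal.ofReal_le_ofReal ?_
  linarith [hbound y p hy hp, hbound y' q hy' hq, dist_triangle_left p q (c s)]

end IsHatPath

end Contraction

/-! ### Projection to a contracting geodesic -/

namespace Contraction

open IsGeodesicSegment

variable {X : Type u} [MetricSpace X]

/-- `x ↦ γ (f x)` is a closest point projection to the `D`-contracting geodesic `γ`, defined
on `I`. -/
structure IsProjection (γ : ℝ → X) (I : Set ℝ) (f : X → ℝ) (D : ℝ) : Prop where
  ordConnected : I.OrdConnected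
  isGeodesicOn : IsGeodesicOn γ I
  mem : ∀ x, f x ∈ I
  dist_le : ∀ x, ∀ t ∈ I, dist x (γ (f x)) ≤ dist x (γ t)
  nonneg : 0 ≤ D
  abs_sub_le : ∀ x y, dist x y < dist x (γ (f x)) → |f x - f y| ≤ D

theorem exists_isProjection {γ : ℝ → X} {I : Set ℝ} {D : ℝ} (hI : I.OrdConnected)
    (hcl : IsClosed I) (hne : I.Nonempty) (hγ : IsGeodesicOn γ I)
    (hD : IsContracting D (γ '' I)) : ∃ f, IsProjection γ I f D := by
  have hex : ∀ x, ∃ s ∈ I, ∀ t ∈ I, dist x (γ s) ≤ dist x (γ t) := by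
    intro x
    obtain ⟨t₀, ht₀⟩ := hne
    set r := dist x (γ t₀) with hr
    have hr0 : 0 ≤ r := dist_nonneg
    have hcont : ContinuousOn γ I := by
      have : LipschitzOnWith 1 γ I := LipschitzOnWith.of_dist_le_mul fun s hs t ht => by
        rw [hγ s hs t ht, Real.dist_eq]; simp
      exact this.continuousOn
    -- Parameters farther than `2 * r` from `t₀` give points farther than `r` from `x`, so a compact
    -- piece of `I` suffices.
    obtain ⟨s, hs, hmin⟩ := ((isCompact_Icc (a := t₀ - 2 * r) (b := t₀ + 2 * r)).inter_left
      hcl).exists_isMinOn (f := fun t => dist x (γ t)) ⟨t₀, ht₀, by linarith, by linarith⟩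
      ((continuous_const.dist continuous_id).comp_continuousOn (hcont.mono inter_subset_left))
    have hmin' : ∀ t ∈ I ∩ Icc (t₀ - 2 * r) (t₀ + 2 * r), dist x (γ s) ≤ dist x (γ t) :=
      fun t ht => hmin ht
    refine ⟨s, hs.1, fun t ht => ?_⟩
    by_cases htr : t ∈ Icc (t₀ - 2 * r) (t₀ + 2 * r)
    · exact hmin' t ⟨ht, htr⟩
    · have h1 := hmin' t₀ ⟨ht₀, by linarith, by linarith⟩
      have h2 := dist_triangle_left (γ t₀) (γ t) x
      rw [hγ t₀ ht₀ t ht] at h2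
      have h3 : 2 * r < |t₀ - t| := by
        by_contra! hle
        have := abs_le.1 hle
        exact htr ⟨by linarith, by linarith⟩
      linarith
  choose f hf hmin using hex
  have hclosest : ∀ x, γ (f x) ∈ closestPoints (γ '' I) x := fun x =>
    ⟨mem_image_of_mem γ (hf x), by rintro _ ⟨t, ht, rfl⟩; exact hmin x t ht⟩
  refine ⟨f, hI, hγ, hf, hmin, hD.1, fun x y hxy => ?_⟩
  have hinf : dist x (γ (f x)) ≤ infDist x (γ '' I) :=
    (le_infDist (hne.image γ)).2 (fun z hz => (hclosest x).2 z hz)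
  have h1 : γ (f x) ∈ ⋃ z ∈ ball x (infDist x (γ '' I)), closestPoints (γ '' I) z :=
    mem_biUnion (mem_ball_self (by linarith [dist_nonneg (x := x) (y := y)])) (hclosest x)
  have h2 : γ (f y) ∈ ⋃ z ∈ ball x (infDist x (γ '' I)), closestPoints (γ '' I) z :=
    mem_biUnion (mem_ball'.2 (by linarith)) (hclosest y)
  have h3 := (edist_le_ediam_of_mem h1 h2).trans (hD.2 x)
  rw [edist_dist, ENNReal.ofReal_le_ofReal_iff hD.1, hγ _ (hf x) _ (hf y)] at h3
  exact h3

/-- Three steps crossing an interval of length `6 * E`: one of them covers an outer third or the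
middle third, of length `2 * E`. -/
theorem exists_long_jump {a₀ a₁ a₂ a₃ μ E : ℝ} (hE : 0 < E) (h0 : a₀ ≤ μ - 3 * E)
    (h3 : μ + 3 * E ≤ a₃) : ∃ t, |t - μ| ≤ 3 * E ∧ ((E < |a₀ - a₁| ∧ t ∈ uIcc a₀ a₁) ∨
      (E < |a₁ - a₂| ∧ t ∈ uIcc a₁ a₂) ∨ (E < |a₂ - a₃| ∧ t ∈ uIcc a₂ a₃)) := by
  rcases le_or_gt (μ - E) a₁ with h1 | h1
  · refine ⟨μ - 3 * E, by rw [abs_le]; constructor <;> linarith, .inl ⟨?_, ?_⟩⟩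
    · rw [abs_sub_comm]; exact lt_of_lt_of_le (by linarith) (le_abs_self _)
    · rw [uIcc_of_le (by linarith)]; constructor <;> linarith
  rcases le_or_gt (μ + E) a₂ with h2 | h2
  · refine ⟨μ, by simp; linarith, .inr (.inl ⟨?_, ?_⟩)⟩
    · rw [abs_sub_comm]; exact lt_of_lt_of_le (by linarith) (le_abs_self _)
    · rw [uIcc_of_le (by linarith)]; constructor <;> linarith
  · refine ⟨μ + 3 * E, by rw [abs_le]; constructor <;> linarith, .inr (.inr ⟨?_, ?_⟩)⟩
    · rw [abs_sub_comm]; exact lt_of_lt_of_le (by linarith) (le_abs_self _)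
    · rw [uIcc_of_le (by linarith)]; constructor <;> linarith

namespace IsProjection

variable {γ : ℝ → X} {I : Set ℝ} {f : X → ℝ} {D : ℝ}

theorem neg (h : IsProjection γ I f D) : IsProjection (fun t => γ (-t)) (-I) (fun x => -f x) D where
  ordConnected := ⟨fun a ha b hb t ht =>
    h.ordConnected.out hb ha ⟨neg_le_neg ht.2, neg_le_neg ht.1⟩⟩
  isGeodesicOn s hs t ht := by
    rw [h.isGeodesicOn _ hs _ ht, abs_sub_comm]; congr 1; ring
  mem x := by simpa using h.mem x
  dist_le x t ht := by simpa using h.dist_le x _ ht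
  nonneg := h.nonneg
  abs_sub_le x y hxy := by
    rw [neg_neg] at hxy
    rw [neg_sub_neg, abs_sub_comm]
    exact h.abs_sub_le x y hxy

theorem abs_sub_eq (h : IsProjection γ I f D) (x y : X) :
    |f x - f y| = dist (γ (f x)) (γ (f y)) := (h.isGeodesicOn _ (h.mem x) _ (h.mem y)).symm

theorem apply_self (h : IsProjection γ I f D) {t : ℝ} (ht : t ∈ I) : f (γ t) = t := by
  have h1 := h.dist_le (γ t) t ht
  rw [dist_self, h.isGeodesicOn _ ht _ (h.mem _)] at h1
  linarith [abs_eq_zero.1 (le_antisymm h1 (abs_nonneg _))]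

/-- Either contraction applies at `x`, or `x` is within `dist x y` of `γ` and the triangle
inequality suffices. -/
theorem abs_sub_le_add (h : IsProjection γ I f D) (x y : X) :
    |f x - f y| ≤ D + 4 * dist x y := by
  rcases lt_or_ge (dist x y) (dist x (γ (f x))) with hlt | hge
  · linarith [h.abs_sub_le x y hlt, dist_nonneg (x := x) (y := y)]
  · have h1 := h.dist_le y (f x) (h.mem x)
    have h2 := dist_triangle y x (γ (f x))
    have h3 := dist_triangle4 (γ (f x)) x y (γ (f y))
    rw [dist_comm y x] at h2
    rw [dist_comm _ x] at h3
    rw [h.abs_sub_eq]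
    linarith [h.nonneg]

theorem abs_sub_le_of_dist_le (h : IsProjection γ I f D) {x : X} {t a : ℝ} (ht : t ∈ I)
    (hx : dist x (γ t) ≤ a) : |f x - t| ≤ 2 * a := by
  rw [← h.isGeodesicOn _ (h.mem x) _ ht]
  linarith [dist_triangle_left (γ (f x)) (γ t) x, h.dist_le x t ht]

theorem abs_sub_le_nat_mul (h : IsProjection γ I f D) {R : ℝ} (hR : 0 < R) (n : ℕ) :
    ∀ {S : Set X} {u v : X}, IsGeodesicSegment S u v → (∀ w ∈ S, R ≤ dist w (γ (f w))) →
      dist u v ≤ (n + 1) * (R / 2) → |f u - f v| ≤ (n + 1) * D := by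
  induction n with
  | zero =>
    intro S u v hS hw hd
    simp only [Nat.cast_zero, zero_add, one_mul] at hd ⊢
    exact h.abs_sub_le u v (by linarith [hw u hS.left_mem])
  | succ n ih =>
    intro S u v hS hw hd
    push_cast at hd ⊢
    rcases le_total (dist u v) (R / 2) with hle | hle
    · have := h.abs_sub_le u v (by linarith [hw u hS.left_mem])
      have : 0 ≤ (n : ℝ) * D := mul_nonneg n.cast_nonneg h.nonneg
      linarith [h.nonneg]
    · obtain ⟨w, hwS, hwd⟩ := hS.exists_dist_eq (t := R / 2) (by linarith) hle
      obtain ⟨S', hS', hs⟩ := hS.exists_sub hwS hS.right_mem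
      have h1 := ih hs (fun z hz => hw z (hS' hz)) (by linarith [hS.dist_add_dist hwS])
      have h2 := h.abs_sub_le u w (by linarith [hw u hS.left_mem])
      linarith [_root_.abs_sub_le (f u) (f w) (f v)]

/-- Geodesics far away from `γ` have bounded projection. -/
theorem abs_sub_le_of_far (h : IsProjection γ I f D) {S : Set X} {a b : X}
    (hS : IsGeodesicSegment S a b) (hfar : ∀ w ∈ S, 4 * D + 4 ≤ dist w (γ (f w))) :
    |f a - f b| ≤ 6 * D + 2 := by
  have hD := h.nonneg
  set ρa := dist a (γ (f a)) with hρa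
  set ρb := dist b (γ (f b)) with hρb
  have ha := hfar a hS.left_mem
  have hb := hfar b hS.right_mem
  rcases lt_or_ge (dist a b) ρa with hlt | hge
  · linarith [h.abs_sub_le a b hlt]
  -- Cut off almost all of the distance to `γ` at each end, at cost `D` each. What remains has
  -- length at most `Δ + 2`, and pieces of length `2 * D + 2` project to at most `D`, so the middle
  -- contributes less than half of `Δ` up to a constant.
  obtain ⟨a', ha', hda⟩ := hS.exists_dist_eq (t := ρa - 1) (by linarith) (by linarith)
  have h1 := h.abs_sub_le a a' (by linarith)
  have e1 := hS.dist_add_dist ha'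
  have t1 := _root_.abs_sub_le (f a) (f a') (f b)
  rcases lt_or_ge (dist a' b) ρb with hlt' | hge'
  · have h2 := h.abs_sub_le b a' (by rwa [dist_comm])
    rw [abs_sub_comm] at h2
    linarith
  obtain ⟨S', hS', hs⟩ := hS.exists_sub ha' hS.right_mem
  obtain ⟨b', hb', hdb⟩ := hs.exists_dist_eq (t := dist a' b - (ρb - 1)) (by linarith) (by linarith)
  have e2 := hs.dist_add_dist hb'
  have h2 := h.abs_sub_le b b' (by rw [dist_comm]; linarith)
  rw [abs_sub_comm] at h2
  have t2 := _root_.abs_sub_le (f a') (f b') (f b)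
  obtain ⟨S'', hS'', hs'⟩ := hs.exists_sub hs.left_mem hb'
  set Δ := |f a - f b| with hΔ
  have hΔ0 : 0 ≤ Δ := abs_nonneg _
  have t3 := dist_triangle4 a (γ (f a)) (γ (f b)) b
  rw [← h.abs_sub_eq, dist_comm (γ (f b)) b] at t3
  have hlen : dist a' b' ≤ Δ + 2 := by linarith
  set n := ⌊(Δ + 2) / (2 * D + 2)⌋₊ with hn
  have hn1 : (n : ℝ) ≤ (Δ + 2) / (2 * D + 2) := Nat.floor_le (by positivity)
  have hn2 : (Δ + 2) / (2 * D + 2) < n + 1 := Nat.lt_floor_add_one _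
  rw [div_lt_iff₀ (by linarith)] at hn2
  rw [le_div_iff₀ (by linarith)] at hn1
  have h3 := h.abs_sub_le_nat_mul (R := 4 * D + 4) (by linarith) n hs'
    (fun w hw => hfar w (hS' (hS'' hw))) (by linarith)
  have hn0 : (0 : ℝ) ≤ n := n.cast_nonneg
  linarith

/-- A geodesic with large projection passes close to the points of the projection. -/
theorem exists_dist_le (h : IsProjection γ I f D) {S : Set X} {a b : X} {t : ℝ}
    (hS : IsGeodesicSegment S a b) (hfar : 6 * D + 2 < |f a - f b|) (ht : t ∈ uIcc (f a) (f b)) :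
    ∃ w ∈ S, dist w (γ t) ≤ 11 * D + 11 := by
  wlog hab : f a ≤ f b generalizing a b
  · exact this hS.symm (by rwa [abs_sub_comm]) (by rwa [uIcc_comm]) (le_of_not_ge hab)
  rw [uIcc_of_le hab] at ht
  have hD := h.nonneg
  have htI : t ∈ I := h.ordConnected.out (h.mem a) (h.mem b) ht
  obtain ⟨w, hw, hwt⟩ : ∃ w ∈ S, |f w - t| ≤ D + 4 := by
    set T : Set ℝ := {d | ∃ w ∈ S, f w ≤ t ∧ dist a w = d} with hT
    have hle : ∀ w ∈ S, dist a w ≤ dist a b := fun w hw => by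
      linarith [hS.dist_add_dist hw, dist_nonneg (x := w) (y := b)]
    have hTne : T.Nonempty := ⟨_, a, hS.left_mem, ht.1, rfl⟩
    have hTb : BddAbove T := ⟨dist a b, by rintro _ ⟨w, hw, -, rfl⟩; exact hle w hw⟩
    obtain ⟨_, ⟨w, hw, hfw, rfl⟩, hws⟩ := exists_lt_of_lt_csSup hTne (sub_one_lt (sSup T))
    obtain ⟨v, hv, hfv⟩ : ∃ v, dist w v ≤ 1 ∧ t ≤ f v := by
      rcases le_total (dist a w + 1) (dist a b) with hle' | hle'
      · obtain ⟨v, hv, hd⟩ := hS.exists_dist_eq (t := dist a w + 1) (by positivity) hle'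
        refine ⟨v, by rw [hS.dist_eq_sub hw hv (by linarith)]; linarith, ?_⟩
        by_contra! hlt
        linarith [le_csSup hTb ⟨v, hv, hlt.le, rfl⟩]
      · exact ⟨b, by linarith [hS.dist_add_dist hw], ht.2⟩
    refine ⟨w, hw, ?_⟩
    have := abs_le.1 (h.abs_sub_le_add w v)
    rw [abs_le]
    constructor <;> linarith
  have hγt : ∀ e, dist e (γ t) ≤ dist e (γ (f e)) + |f e - t| := fun e => by
    rw [← h.isGeodesicOn _ (h.mem e) _ htI]; exact dist_triangle _ _ _
  rcases lt_or_ge (4 * D + 5) (dist w (γ (f w))) with hlt | hge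
  swap
  · exact ⟨w, hw, by linarith [hγt w]⟩
  -- the closest point of the segment which is close to `γ`
  have hlip : ∀ x y, dist x (γ (f x)) ≤ dist x y + dist y (γ (f y)) := fun x y =>
    (h.dist_le x (f y) (h.mem y)).trans (dist_triangle _ _ _)
  have hcont : Continuous fun e => dist e (γ (f e)) := by
    have : LipschitzWith 1 (fun e => dist e (γ (f e))) := LipschitzWith.of_le_add fun x y => by
      linarith [hlip x y]
    exact this.continuous
  -- Walk from `w` to the first such point: up to there the segment is far from `γ`, so the
  -- projection moves by at most `6 * D + 2`. In total (4D + 5) + (6D + 2) + (D + 4) = 11D + 11.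
  have hex : ∃ e ∈ S, dist e (γ (f e)) ≤ 4 * D + 5 := by
    by_contra! hall
    exact absurd (h.abs_sub_le_of_far hS fun e he => by linarith [hall e he]) (not_le.2 hfar)
  obtain ⟨e₀, he₀, he₀'⟩ := hex
  obtain ⟨e, ⟨he, he'⟩, hmin⟩ := (hS.isCompact.inter_right
    (isClosed_le hcont continuous_const)).exists_isMinOn (f := fun e => dist w e)
    ⟨e₀, he₀, he₀'⟩ (by fun_prop)
  have he'' : dist e (γ (f e)) ≤ 4 * D + 5 := he'
  have hmin' : ∀ z ∈ S, dist w z < dist w e → 4 * D + 5 < dist z (γ (f z)) := by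
    intro z hz hlt
    by_contra! hle
    have : dist w e ≤ dist w z := hmin ⟨hz, hle⟩
    linarith
  obtain ⟨A, hA, hA'⟩ := hS.exists_sub hw he
  have hfarA : ∀ z ∈ A, 4 * D + 4 ≤ dist z (γ (f z)) := by
    intro z hz
    have e1 := hA'.dist_add_dist hz
    rcases lt_or_ge (dist w z) (dist w e) with hlt' | hge'
    · linarith [hmin' z (hA hz) hlt']
    · have hze : dist z e = 0 := le_antisymm (by linarith) dist_nonneg
      rcases le_total 1 (dist w e) with hle | hle
      · obtain ⟨y, hy, hd⟩ := hA'.exists_dist_eq (t := dist w e - 1) (by linarith) (by linarith)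
        have e2 := hA'.dist_add_dist hy
        have e3 := hmin' y (hA hy) (by linarith)
        linarith [hlip y z, dist_triangle_right y z e]
      · linarith [hlip w z]
  have e1 := h.abs_sub_le_of_far hA' hfarA
  refine ⟨e, he, ?_⟩
  have e2 := _root_.abs_sub_le (f e) (f w) t
  rw [abs_sub_comm] at e1
  linarith [hγt e]

/-- If a geodesic issued from `e` passes close to `γ α` and later close to `γ β`, then `e`
does not project far away from `γ α` in the direction of `γ β`. -/
theorem apply_le_of_close (h : IsProjection γ I f D) {K : ℝ} (hK : K = 11 * D + 11) {S : Set X}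
    {e x y : X} {α β : ℝ} (hS : IsGeodesicSegment S e y) (hx : x ∈ S) (hα : α ∈ I) (hβ : β ∈ I)
    (hxα : dist x (γ α) ≤ K) (hyβ : dist y (γ β) ≤ K) (hαβ : 4 * K < β - α) :
    f e ≤ α + 4 * K := by
  by_contra! hlt
  have hD := h.nonneg
  have hfx := abs_le.1 (h.abs_sub_le_of_dist_le hα hxα)
  obtain ⟨A, hA, hA'⟩ := hS.exists_sub hS.left_mem hx
  -- The geodesic from `e` to `x` would pass near `γ t`, with `t` well beyond `α`, then return to `γ
  -- α` before going to `γ β`: too long for a geodesic.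
  set t := min (f e) β with ht
  have ht1 : α + 4 * K < t := lt_min hlt (by linarith)
  have ht2 : t ≤ f e := min_le_left _ _
  have ht3 : t ≤ β := min_le_right _ _
  obtain ⟨w, hw, hwt⟩ := h.exists_dist_le (t := t) hA'
    (lt_of_lt_of_le (by linarith) (le_abs_self _))
    (by rw [uIcc_comm, uIcc_of_le (by linarith)]; exact ⟨by linarith, ht2⟩)
  have htI : t ∈ I := h.ordConnected.out hα hβ ⟨by linarith, ht3⟩
  have e1 := hA'.dist_add_dist hw
  have e2 := hS.dist_add_dist (hA hw)
  have e3 := hS.dist_add_dist hx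
  have d1 := h.isGeodesicOn _ htI _ hα
  have d2 := h.isGeodesicOn _ htI _ hβ
  have d3 := h.isGeodesicOn _ hα _ hβ
  rw [abs_of_nonneg (by linarith)] at d1
  rw [abs_sub_comm, abs_of_nonneg (by linarith)] at d2 d3
  have t1 := dist_triangle4 (γ t) w x (γ α)
  have t2 := dist_triangle4 w (γ t) (γ β) y
  have t3 := dist_triangle4 (γ α) x y (γ β)
  rw [dist_comm (γ t) w] at t1
  rw [dist_comm (γ β) y] at t2
  rw [dist_comm (γ α) x] at t3
  linarith

/-- Anti-contracting pairs have bounded projection. -/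
theorem abs_sub_le_of_antiContracting (hX : IsGeodesicSpace X) (h : IsProjection γ I f D) :
    ∃ M, 0 ≤ M ∧ ∀ x y, AntiContracting x y → |f x - f y| ≤ M := by
  have hD := h.nonneg
  set K := 11 * D + 11 with hK
  set E := 6 * D + 2 with hE
  -- A side passing within `K` of some `γ t` with `|t - μ| ≤ 3 * E` is within `K + 3 * E + 3 * K` of
  -- the midpoint.
  set r := 4 * K + 3 * E with hr
  refine ⟨10 * r + 20 * K + 10 * E + 1, by positivity, fun x y hxy => ?_⟩
  wlog hle : f x ≤ f y generalizing x y
  · rw [abs_sub_comm]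
    exact this y x hxy.symm (le_of_not_ge hle)
  by_contra! hlt
  rw [abs_sub_comm, abs_of_nonneg (by linarith)] at hlt
  set α := f x with hα
  set β := f y with hβ
  set μ := (α + β) / 2 with hμ
  have hαI : α ∈ I := h.mem x
  have hβI : β ∈ I := h.mem y
  have hμI : μ ∈ I := h.ordConnected.out hαI hβI ⟨by linarith, by linarith⟩
  have hbig : E < |f x - f y| := by
    rw [abs_sub_comm]; exact lt_of_lt_of_le (by linarith) (le_abs_self _)
  obtain ⟨S, hS⟩ := hX x y
  obtain ⟨x', hx', hxα⟩ := h.exists_dist_le hS hbig left_mem_uIcc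
  obtain ⟨y', hy', hyβ⟩ := h.exists_dist_le hS hbig right_mem_uIcc
  obtain ⟨S', hSS, hS'⟩ := hS.exists_sub hx' hy'
  have fx := abs_le.1 (h.abs_sub_le_of_dist_le hαI hxα)
  have fy := abs_le.1 (h.abs_sub_le_of_dist_le hβI hyβ)
  have dαβ := h.isGeodesicOn _ hαI _ hβI
  have dαμ := h.isGeodesicOn _ hαI _ hμI
  have dμβ := h.isGeodesicOn _ hμI _ hβI
  rw [abs_sub_comm, abs_of_nonneg (by linarith)] at dαβ dαμ dμβ
  have hlen : β - α - 2 * K ≤ dist x' y' := by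
    have := dist_triangle4 (γ α) x' y' (γ β)
    rw [dist_comm (γ α) x'] at this
    linarith
  refine hxy.2 r (by positivity) S hS S' x' y' hS' hSS
    (by unfold contractionGauge; linarith) ?_
  intro w Q hQ hsub m hm hmid
  -- the midpoint is close to `γ μ`
  have hmμ : dist m (γ μ) ≤ 3 * K := by
    obtain ⟨z, hz, hzμ⟩ := h.exists_dist_le (t := μ) hS'
      (by rw [abs_sub_comm]; exact lt_of_lt_of_le (by linarith) (le_abs_self _))
      (by rw [uIcc_of_le (by linarith)]; constructor <;> linarith)
    have e1 := hS'.dist_add_dist hm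
    have e2 := hS'.dist_add_dist hz
    rw [dist_comm m x'] at hmid
    have t1 := dist_triangle4 x' (γ α) (γ μ) z
    have t2 := dist_triangle4 z (γ μ) (γ β) y'
    have t3 := dist_triangle4 (γ α) x' z (γ μ)
    have t4 := dist_triangle4 (γ μ) z y' (γ β)
    rw [dist_comm (γ μ) z] at t1
    rw [dist_comm (γ β) y'] at t2
    rw [dist_comm (γ α) x'] at t3
    rw [dist_comm (γ μ) z] at t4
    have e3 : dist m z ≤ 2 * K := by
      rw [hS'.dist_eq_abs hm hz, abs_le]
      constructor <;> linarith
    linarith [dist_triangle m z (γ μ)]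
  have pass : ∀ {V p q t}, IsGeodesicSegment V p q → |t - μ| ≤ 3 * E → E < |f p - f q| →
      t ∈ uIcc (f p) (f q) → ∃ z ∈ V, dist z m ≤ r := by
    intro V p q t hV htμ hpq ht
    obtain ⟨z, hz, hzt⟩ := h.exists_dist_le hV hpq ht
    have htI : t ∈ I := h.ordConnected.uIcc_subset (h.mem p) (h.mem q) ht
    refine ⟨z, hz, ?_⟩
    have := dist_triangle4 z (γ t) (γ μ) m
    rw [h.isGeodesicOn _ htI _ hμI, dist_comm (γ μ) m] at this
    linarith
  -- the ends of the first side project to different sides of `γ μ`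
  have ends : ∀ {V p q}, IsGeodesicSegment V p q → S' ⊆ V → dist p x' ≤ dist p y' →
      f p ≤ μ - 3 * E ∧ μ + 3 * E ≤ f q := by
    intro V p q hV hSV hpxy
    have hx'V := hSV hS'.left_mem
    have hy'V := hSV hS'.right_mem
    have ex := hV.dist_add_dist hx'V
    have ey := hV.dist_add_dist hy'V
    obtain ⟨A, hA, hA'⟩ := hV.exists_sub hV.left_mem hy'V
    obtain ⟨B, hB, hB'⟩ := hV.exists_sub hV.right_mem hx'V
    have h1 := h.apply_le_of_close hK hA' (hV.mem_sub hA hA' hx'V (by simp) hpxy)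
      hαI hβI hxα hyβ (by linarith)
    have h2 := h.neg.apply_le_of_close (α := -β) (β := -α) hK hB'
      (hV.symm.mem_sub hB hB' hy'V (by simp) (by rw [dist_comm q, dist_comm q]; linarith))
      (by simpa using hβI) (by simpa using hαI) (by simpa using hyβ) (by simpa using hxα)
      (by linarith)
    constructor <;> linarith
  have q0 := hQ 0
  have q1 : IsGeodesicSegment (Q 1) (w 1) (w 2) := hQ 1
  have q2 : IsGeodesicSegment (Q 2) (w 2) (w 3) := hQ 2
  have q3 : IsGeodesicSegment (Q 3) (w 3) (w 0) := hQ 3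
  have q0' : IsGeodesicSegment (Q 0) (w 0) (w 1) := q0
  have hx0 := hsub hS'.left_mem
  have hy0 := hsub hS'.right_mem
  have hE0 : 0 < E := by positivity
  -- The three other sides carry the projection from one side of `μ` to the other, so one of them
  -- has a projection longer than `E` near `μ` and must follow `γ` there.
  suffices hsuff : ∃ z, (z ∈ Q 1 ∨ z ∈ Q 2 ∨ z ∈ Q 3) ∧ dist z m ≤ r by
    obtain ⟨z, hz, hzm⟩ := hsuff
    exact ⟨z, by simpa [or_assoc] using hz, hzm⟩
  rcases le_total (dist (w 0) x') (dist (w 0) y') with hxy0 | hxy0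
  · obtain ⟨g0, g1⟩ := ends q0' hsub hxy0
    obtain ⟨t, ht, (⟨hj, hjt⟩ | ⟨hj, hjt⟩ | ⟨hj, hjt⟩)⟩ :=
      exists_long_jump (a₁ := f (w 3)) (a₂ := f (w 2)) hE0 g0 g1
    · obtain ⟨z, hz, hzm⟩ := pass q3.symm ht hj hjt
      exact ⟨z, .inr (.inr hz), hzm⟩
    · obtain ⟨z, hz, hzm⟩ := pass q2.symm ht hj hjt
      exact ⟨z, .inr (.inl hz), hzm⟩
    · obtain ⟨z, hz, hzm⟩ := pass q1.symm ht hj hjt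
      exact ⟨z, .inl hz, hzm⟩
  · have ex := q0'.dist_add_dist hx0
    have ey := q0'.dist_add_dist hy0
    obtain ⟨g0, g1⟩ := ends q0'.symm hsub (by
      rw [dist_comm (w 1), dist_comm (w 1)]; linarith)
    obtain ⟨t, ht, (⟨hj, hjt⟩ | ⟨hj, hjt⟩ | ⟨hj, hjt⟩)⟩ :=
      exists_long_jump (a₁ := f (w 2)) (a₂ := f (w 3)) hE0 g0 g1
    · obtain ⟨z, hz, hzm⟩ := pass q1 ht hj hjt
      exact ⟨z, .inl hz, hzm⟩
    · obtain ⟨z, hz, hzm⟩ := pass q2 ht hj hjt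
      exact ⟨z, .inr (.inl hz), hzm⟩
    · obtain ⟨z, hz, hzm⟩ := pass q3 ht hj hjt
      exact ⟨z, .inr (.inr hz), hzm⟩

/-- The projection is coarsely Lipschitz for the metric of the contraction space. -/
theorem abs_sub_le_hatDist (hX : IsGeodesicSpace X) (h : IsProjection γ I f D) :
    ∃ K, 0 ≤ K ∧ ∀ x y, |f x - f y| ≤ K * hatDist x y + D := by
  have hD := h.nonneg
  obtain ⟨M, hM, hanti⟩ := h.abs_sub_le_of_antiContracting hX
  set K := 4 + D + M with hK
  have hK0 : 0 < K := by positivity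
  -- The additive error `D` of each move is charged to the jump that follows; only the last move
  -- keeps its own.
  have hroute : ∀ {x q t}, Route q x t → |f x - f q| ≤ K * t + D := by
    intro x q t hr
    induction hr with
    | last y =>
      have h1 := h.abs_sub_le_add y q
      have h2 : 4 * dist y q ≤ K * dist y q :=
        mul_le_mul_of_nonneg_right (by linarith) dist_nonneg
      linarith
    | @leg y y' y'' t ha _ ih =>
      have h1 := h.abs_sub_le_add y y'
      have h2 : 4 * dist y y' ≤ K * dist y y' :=
        mul_le_mul_of_nonneg_right (by linarith) dist_nonneg
      have h3 := hanti _ _ ha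
      have h4 := _root_.abs_sub_le (f y) (f y') (f q)
      have h5 := _root_.abs_sub_le (f y') (f y'') (f q)
      rw [mul_add, mul_add, mul_one]
      linarith
  refine ⟨K, hK0.le, fun x y => le_of_forall_pos_le_add fun ε hε => ?_⟩
  obtain ⟨t, ht, hr⟩ := exists_route x y (div_pos hε hK0)
  have h1 := hroute hr
  have h2 := mul_le_mul_of_nonneg_left ht.le hK0.le
  rw [mul_add, mul_div_cancel₀ _ hK0.ne'] at h2
  linarith

end IsProjection

theorem isQuasiGeodesicOn_of_isStronglyContracting (hX : IsGeodesicSpace X) {γ : ℝ → X} {I : Set ℝ}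
    (hI : I.OrdConnected) (hcl : IsClosed I) (hγ : IsGeodesicOn γ I)
    (h : IsStronglyContracting (γ '' I)) :
    ∃ C, IsQuasiGeodesicOn C (fun t => incl (γ t)) I := by
  rcases I.eq_empty_or_nonempty with rfl | hne
  · exact ⟨1, le_rfl, continuousOn_empty _, by simp⟩
  obtain ⟨D, hD⟩ := h
  obtain ⟨f, hf⟩ := exists_isProjection hI hcl hne hγ hD
  obtain ⟨K, hK, hKf⟩ := hf.abs_sub_le_hatDist hX
  have hD0 := hD.1
  have hle : ∀ s ∈ I, ∀ t ∈ I, dist (incl (γ s)) (incl (γ t)) ≤ |s - t| := fun s hs t ht => by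
    rw [← hγ s hs t ht]; exact hatDist_le_dist _ _
  refine ⟨K + D + 1, by linarith, ?_, fun s hs t ht => ⟨?_, ?_⟩⟩
  · have : LipschitzOnWith 1 (fun t => incl (γ t)) I :=
      LipschitzOnWith.of_dist_le_mul fun s hs t ht => by
        rw [Real.dist_eq]; simpa using hle s hs t ht
    exact this.continuousOn
  · have h1 := hKf (γ s) (γ t)
    have h2 := hatDist_nonneg (γ s) (γ t)
    rw [hf.apply_self hs, hf.apply_self ht, abs_sub_comm] at h1
    rw [sub_le_iff_le_add, div_le_iff₀ (by linarith)]
    change |t - s| ≤ (hatDist (γ s) (γ t) + (K + D + 1)) * (K + D + 1)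
    nlinarith
  · refine (hle s hs t ht).trans ?_
    rw [abs_sub_comm]
    nlinarith [abs_nonneg (t - s)]

theorem isStronglyContracting_of_isQuasiGeodesicOn (hX : IsGeodesicSpace X) {γ : ℝ → X} {I : Set ℝ}
    (hI : I.OrdConnected) (hγ : IsGeodesicOn γ I) {C : ℝ}
    (h : IsQuasiGeodesicOn C (fun t => incl (γ t)) I) : IsStronglyContracting (γ '' I) :=
  IsHatPath.isStronglyContracting (L := 1) (C := C) hX
    { ordConnected := hI
      nonneg := zero_le_one
      one_le := h.1
      dist_le := fun s hs t ht => by rw [hγ s hs t ht, one_mul]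
      le_hatDist := fun s hs t ht => by
        rw [abs_sub_comm]; exact (h.2.2 s hs t ht).1 }

/-! ### Axes of group elements -/

section Elements

variable {G : Type v} [Group G] [MulAction G X] [IsIsometricSMul G X]

theorem smul_incl (g : G) (x : X) : g • (incl x : ContractionSpace X) = incl (g • x) := rfl

/-- The path through an orbit obtained by translating a geodesic segment. -/
theorem exists_axis (hX : IsGeodesicSpace X) (g : G) (x : X) : ∃ c : ℝ → X,
    (∀ t, g • c t = c (t + 1)) ∧ (∀ s t, dist (c s) (c t) ≤ dist x (g • x) * |s - t|) ∧
      ∀ t, dist (c t) (g ^ ⌊t⌋ • x) ≤ dist x (g • x) := by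
  obtain ⟨_, σ, h0, h1, hσ, -⟩ := hX x (g • x)
  set L := dist x (g • x) with hL
  have hL0 : 0 ≤ L := dist_nonneg
  -- The translates of the segment are parametrized at constant speed `L` over unit intervals, so
  -- that `g` shifts the parameter by 1.
  set c : ℝ → X := fun t => g ^ ⌊t⌋ • σ (Int.fract t * L) with hc
  have hfr : ∀ t : ℝ, Int.fract t * L ∈ Icc 0 L := fun t =>
    ⟨mul_nonneg (Int.fract_nonneg t) hL0, mul_le_of_le_one_left hL0 (Int.fract_lt_one t).le⟩
  have left : ∀ t, dist (g ^ ⌊t⌋ • x) (c t) = Int.fract t * L := fun t => by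
    simp only [hc]
    rw [dist_smul, ← h0, hσ 0 ⟨le_rfl, hL0⟩ _ (hfr t), zero_sub, abs_neg,
      abs_of_nonneg (hfr t).1]
  have right : ∀ t, dist (c t) (g ^ (⌊t⌋ + 1) • x) = L - Int.fract t * L := fun t => by
    simp only [hc]
    rw [zpow_add_one, mul_smul, dist_smul, ← h1, hσ _ (hfr t) L ⟨hL0, le_rfl⟩, abs_sub_comm,
      abs_of_nonneg (by linarith [(hfr t).2])]
  have orbit : ∀ (n : ℕ) (a : ℤ), dist (g ^ a • x) (g ^ (a + n) • x) ≤ n * L := by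
    intro n a
    induction n with
    | zero => simp
    | succ n ih =>
      have h2 : dist (g ^ (a + n) • x) (g ^ (a + (n + 1 : ℕ)) • x) = L := by
        rw [Nat.cast_succ, ← add_assoc, zpow_add_one, mul_smul, dist_smul]
      have h3 := dist_triangle (g ^ a • x) (g ^ (a + n) • x) (g ^ (a + (n + 1 : ℕ)) • x)
      push_cast at *
      linarith
  have key : ∀ s t, s ≤ t → dist (c s) (c t) ≤ L * |s - t| := by
    intro s t hst
    rw [abs_sub_comm, abs_of_nonneg (by linarith)]
    have es := Int.floor_add_fract s
    have et := Int.floor_add_fract t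
    rcases (Int.floor_mono hst).eq_or_lt with he | hlt
    · have hd : dist (c s) (c t) = |Int.fract s * L - Int.fract t * L| := by
        simp only [hc]
        rw [he, dist_smul, hσ _ (hfr s) _ (hfr t)]
      have hcast : (⌊s⌋ : ℝ) = ⌊t⌋ := by rw [he]
      have e2 : t - s = Int.fract t - Int.fract s := by linarith
      have e3 : 0 ≤ Int.fract t - Int.fract s := by linarith
      rw [hd, e2, abs_sub_comm, ← sub_mul, abs_of_nonneg (mul_nonneg e3 hL0), mul_comm]
    · obtain ⟨n, hn⟩ := Int.le.dest (Int.add_one_le_iff.2 hlt)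
      have h2 := orbit n (⌊s⌋ + 1)
      rw [hn] at h2
      have h3 := dist_triangle4 (c s) (g ^ (⌊s⌋ + 1) • x) (g ^ ⌊t⌋ • x) (c t)
      rw [left, right] at h3
      have hcast : (⌊s⌋ : ℝ) + 1 + n = ⌊t⌋ := by exact_mod_cast hn
      have e2 : t - s = 1 + n + Int.fract t - Int.fract s := by linarith
      rw [e2]
      linarith
  refine ⟨c, fun t => ?_, fun s t => ?_, fun t => ?_⟩
  · simp only [hc]
    rw [Int.floor_add_one, Int.fract_add_one, smul_smul, zpow_add_one,
      ((Commute.refl g).zpow_right _).eq]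
  · rcases le_total s t with hst | hst
    · exact key s t hst
    · rw [dist_comm, abs_sub_comm]; exact key t s hst
  · rw [dist_comm, left]; exact (hfr t).2

end Elements

end Contraction

/-! ### Loxodromic elements -/

namespace Contraction

open IsGeodesicSegment

variable {X : Type u} [MetricSpace X]

theorem exists_dist_incl_le_one (z : ContractionSpace X) : ∃ x : X, dist z (incl x) ≤ 1 := by
  obtain ⟨p, rfl⟩ := SeparationQuotient.surjective_mk z
  rcases p with x | ⟨a, s⟩
  · exact ⟨x, by rw [incl, dist_self]; exact zero_le_one⟩
  · refine ⟨a.1.1, (dist_le_of_chain ((Chain.inEdge a s 0).trans (.source a))).trans ?_⟩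
    rw [add_zero, Subtype.dist_eq, Real.dist_eq, abs_of_nonneg (by simpa using s.2.1)]
    simpa using s.2.2

variable {G : Type v} [Group G] [MulAction G X] [IsIsometricSMul G X]

theorem dist_smul_contractionSpace (g : G) (z w : ContractionSpace X) :
    dist (g • z) (g • w) = dist z w := by
  obtain ⟨p, rfl⟩ := SeparationQuotient.surjective_mk z
  obtain ⟨q, rfl⟩ := SeparationQuotient.surjective_mk w
  exact dist_smul g p q

theorem IsQuasiGeodesicOn.mono {Z : Type*} [MetricSpace Z] {C C' : ℝ} {c : ℝ → Z} {I : Set ℝ}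
    (h : IsQuasiGeodesicOn C c I) (hC : C ≤ C') : IsQuasiGeodesicOn C' c I := by
  refine ⟨h.1.trans hC, h.2.1, fun s hs t ht => ?_⟩
  obtain ⟨h1, h2⟩ := h.2.2 s hs t ht
  have h3 : |t - s| / C' ≤ |t - s| / C :=
    div_le_div_of_nonneg_left (abs_nonneg _) (by linarith [h.1]) hC
  have h4 : C * |t - s| ≤ C' * |t - s| := mul_le_mul_of_nonneg_right hC (abs_nonneg _)
  constructor <;> linarith

theorem IsContracting.mono {D D' : ℝ} {Y : Set X} (h : IsContracting D Y) (hD : D ≤ D') :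
    IsContracting D' Y :=
  ⟨h.1.trans hD, fun x => (h.2 x).trans (ENNReal.ofReal_le_ofReal hD)⟩

/-- Move the base point to X at cost 1; the axis through its orbit is Lipschitz in X and a
quasi-geodesic for `hatDist`, hence strongly contracting. Since `hatDist` is at most `dist`, it is
also a quasi-geodesic in X. -/
theorem isStronglyContractingElement_of_isLoxodromic (hX : IsGeodesicSpace X) (g : G)
    (h : IsLoxodromic g (ContractionSpace X)) : IsStronglyContractingElement g X := by
  obtain ⟨z, C, hC, hz⟩ := h
  obtain ⟨x, hx⟩ := exists_dist_incl_le_one z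
  obtain ⟨c, hgc, hlip, hcx⟩ := exists_axis hX g x
  set L := dist x (g • x) with hL
  have hL0 : 0 ≤ L := dist_nonneg
  have horbit : ∀ m n : ℤ, |(m : ℝ) - n| / C - C - 2 ≤ hatDist (g ^ m • x) (g ^ n • x) := by
    intro m n
    have h1 := (hz m n).1
    have h2 := dist_triangle4 (g ^ m • z) (incl (g ^ m • x)) (incl (g ^ n • x)) (g ^ n • z)
    have h3 : ∀ k : ℤ, dist (g ^ k • z) (incl (g ^ k • x)) ≤ 1 := fun k => by
      rw [← smul_incl, dist_smul_contractionSpace]; exact hx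
    have h4 := h3 n
    rw [dist_comm] at h4
    have h5 : hatDist (g ^ m • x) (g ^ n • x) = dist (incl (g ^ m • x)) (incl (g ^ n • x)) := rfl
    linarith [h3 m]
  set C' := C + 3 + 2 * L with hC'
  have hC0 : 0 < C := by linarith
  have hpath : IsHatPath c univ L C' :=
    { ordConnected := ordConnected_univ
      nonneg := hL0
      one_le := by linarith
      dist_le := fun s _ t _ => hlip s t
      le_hatDist := fun s _ t _ => by
        have h1 := horbit ⌊s⌋ ⌊t⌋
        have h2 := hatDist_triangle (g ^ ⌊s⌋ • x) (c s) (g ^ ⌊t⌋ • x)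
        have h3 := hatDist_triangle (c s) (c t) (g ^ ⌊t⌋ • x)
        have h4 := (hatDist_le_dist _ _).trans (hcx s)
        have h5 := (hatDist_le_dist _ _).trans (hcx t)
        rw [hatDist_comm] at h4
        have h6 : |s - t| - 1 ≤ |(⌊s⌋ : ℝ) - ⌊t⌋| := by
          have e1 := Int.floor_le s
          have e2 := Int.lt_floor_add_one s
          have e3 := Int.floor_le t
          have e4 := Int.lt_floor_add_one t
          rw [sub_le_iff_le_add, abs_le]
          have e5 := le_abs_self ((⌊s⌋ : ℝ) - ⌊t⌋)
          have e6 := neg_abs_le ((⌊s⌋ : ℝ) - ⌊t⌋)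
          constructor <;> linarith
        have h7 : (|s - t| - 1) / C ≤ |(⌊s⌋ : ℝ) - ⌊t⌋| / C := by gcongr
        have h8 : |s - t| / C' ≤ |s - t| / C :=
          div_le_div_of_nonneg_left (abs_nonneg _) hC0 (by linarith)
        have h9 : 1 / C ≤ 1 := (div_le_one hC0).2 hC
        rw [sub_div] at h7
        linarith }
  obtain ⟨D, hD⟩ := hpath.isStronglyContracting hX
  rw [image_univ] at hD
  have hquasi : IsQuasiGeodesicOn (C' + L) c univ := by
    refine ⟨by linarith, hpath.continuousOn, fun s _ t _ => ⟨?_, ?_⟩⟩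
    · have h1 := (hpath.le_hatDist s trivial t trivial).trans (hatDist_le_dist _ _)
      have h2 : |s - t| / (C' + L) ≤ |s - t| / C' :=
        div_le_div_of_nonneg_left (abs_nonneg _) (by linarith) (by linarith)
      rw [abs_sub_comm]
      linarith
    · have h1 := hlip s t
      have h2 : L * |s - t| ≤ (C' + L) * |s - t| :=
        mul_le_mul_of_nonneg_right (by linarith) (abs_nonneg _)
      rw [abs_sub_comm]
      linarith
  have hint : ∀ n : ℤ, c n = g ^ n • c 0 := by
    intro n
    induction n using Int.induction_on with
    | zero => simp
    | succ n ih =>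
      rw [zpow_add_one, ((Commute.refl g).zpow_left _).eq, mul_smul, ← ih, hgc]
      push_cast; rfl
    | pred n ih =>
      rw [zpow_sub_one, ((Commute.refl g).inv_right.zpow_left _).eq, mul_smul, ← ih,
        eq_inv_smul_iff, hgc]
      congr 1; push_cast; ring
  refine ⟨⟨c 0, C' + L, hquasi.1, fun m n => ?_⟩, max (C' + L) D, c,
    hquasi.mono (le_max_left _ _), hD.mono (le_max_right _ _), ?_⟩
  · rw [← hint, ← hint, abs_sub_comm]
    exact hquasi.2.2 m trivial n trivial
  · rw [← image_smul, ← range_comp]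
    have : ((fun y => g • y) ∘ c) = c ∘ fun t => t + 1 := funext hgc
    rw [this]
    exact (Equiv.addRight (1 : ℝ)).surjective.range_comp c

end Contraction

theorem mainTheorem5 {X : Type u} [MetricSpace X] (hX : Contraction.IsGeodesicSpace X) :
    (∀ (I : Set ℝ) (γ : ℝ → X), I.OrdConnected → IsClosed I →
      Contraction.IsGeodesicOn γ I →
        ((∃ C : ℝ, Contraction.IsQuasiGeodesicOn C (fun t => Contraction.incl (γ t)) I) ↔
          Contraction.IsStronglyContracting (γ '' I)) ∧
        (∀ x p q : X, p ∈ Contraction.closestPoints (γ '' I) x → q ∈ γ '' I →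
          Contraction.incl q ∈
            Contraction.closestPoints (Contraction.incl '' (γ '' I)) (Contraction.incl x) →
          dist (Contraction.incl p) (Contraction.incl q) < 17)) ∧
    (∀ (G : Type v) [Group G] [MulAction G X] [IsIsometricSMul G X] (g : G),
      Contraction.IsLoxodromic g (Contraction.ContractionSpace X) →
        Contraction.IsStronglyContractingElement g X) := by
  refine ⟨fun I γ hI hcl hγ => ⟨⟨?_, ?_⟩, ?_⟩, ?_⟩
  · rintro ⟨C, hC⟩
    exact Contraction.isStronglyContracting_of_isQuasiGeodesicOn hX hI hγ hC
  · exact Contraction.isQuasiGeodesicOn_of_isStronglyContracting hX hI hcl hγ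
  · rintro x _ _ ⟨⟨s, hs, rfl⟩, hp⟩ ⟨t, ht, rfl⟩ ⟨-, hq⟩
    have hseg : ∃ S ⊆ γ '' I, Contraction.IsGeodesicSegment S (γ s) (γ t) := by
      rcases le_total s t with hst | hst
      · exact ⟨γ '' Icc s t, image_mono (hI.out hs ht),
          .of_geodesicOn hst fun a ha b hb => hγ a (hI.out hs ht ha) b (hI.out hs ht hb)⟩
      · exact ⟨γ '' Icc t s, image_mono (hI.out ht hs),
          .symm (.of_geodesicOn hst fun a ha b hb =>
            hγ a (hI.out ht hs ha) b (hI.out ht hs hb))⟩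
    obtain ⟨S, hS, hS'⟩ := hseg
    exact Contraction.hatDist_lt_of_closest hX hp
      (fun y hy => hq _ (mem_image_of_mem _ hy)) hS' hS
  · intro G _ _ _ g hg
    exact Contraction.isStronglyContractingElement_of_isLoxodromic hX g hg
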